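/- Let $G$ be a finite group. A \emph{semigroup} means a commutative monoid (written additively). A \emph{Mackey functor} is a product-preserving functor to sets from the category of finite $G$-sets and isomorphism classes of spans; it has restrictions $R_f$ and transfers $T_f$, and each $M(X)$ is a semigroup. A \emph{Tambara functor} $S$ is a product-preserving functor to sets from the category of finite $G$-sets and isomorphism classes of bispans; it has moreover norms $N_f$, and each $S(X)$ is a commutative semiring. $S$ is \emph{additively complete} if every $S(X)$ has additive inverses. A \emph{naive $S$-module} is a Mackey functor $M$ with an associative and unital map $S\mathbin{\square}M\to M$ from the box product, that is, with associative and unital pairings $S(X)\times M(Y)\to M(X\times Y)$ natural in $X$ and $Y$ with respect to spans; restricting along the diagonal gives an action of $S(X)$ on $M(X)$. An \emph{$S$-module} is a commutative monoid object in the category of augmented $S$-algebras, i.e. of Tambara functors $T$ with morphisms $S\xrightarrow{\eta}T\xrightarrow{\epsilon}S$, $\epsilon\eta=1$ (products in this category are fibre products over $S$; write $\sigma\colon T\times_ST\to T$ for the addition). Let $\Lambda\colon\mathrm{Mod}_S\to\mathrm{NMod}_S$ be the functor $(\Lambda T)(X)=\{a\in T(X):\epsilon(a)=0\}$, with $S$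 acting through $\eta$. (1) For every Tambara functor $S$ there is a functor $\Pi\colon\mathrm{NMod}_S\to\mathrm{Mod}_S$ such that the Mackey functor underlying $\Pi M$ is, naturally in $M$, $S\oplus M$, with $\eta(a)=(a,0)$, $\epsilon(a,m)=a$, $\sigma((a,m),(a,m'))=(a,m+m')$, and, for $f\colon X\to Y$, \[ N_f(a,m)=\bigl(N_f(a),\;T_f(N_\pi R_{\pi'}(a)\cdot m)\bigr), \] where $\pi(x,x')=x$ and $\pi'(x,x')=x'$ on $F(f)=\{(x,x')\in X^2: x\ne x',\ f(x)=f(x')\}$. The map $(0,m)\mapsto m$ is a natural isomorphism $\Lambda\Pi(M)\cong M$ of naive $S$-modules. The map $\phi(a,m)=\eta(a)+m$ is a morphism of Mackey functors $\phi\colon\Pi\Lambda(T)\to T$, natural in $T\in\mathrm{Mod}_S$, and it is an isomorphism if $S$ is additively complete. (2) However, $\phi$ need not be a morphism of Tambara functors: for every group $G$ of order $2$ there are an additively complete Tambara functor $S$ and an $S$-module $T$ for which $\phi\colon\Pi\Lambda(T)\to T$ is not a morphism of Tambara functors. -/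

import Mathlib

open CategoryTheory

universe u w

/-- A finite `G`-set. -/
structure FinGSet (G : Type u) [Group G] where
  carrier : Type u
  [finite : Finite carrier]
  [action : MulAction G carrier]

namespace FinGSet

variable {G : Type u} [Group G]

instance : CoeSort (FinGSet G) (Type u) := ⟨FinGSet.carrier⟩

instance (X : FinGSet G) : Finite X := X.finite

instance (X : FinGSet G) : MulAction G X := X.action

/-- Equivariant maps. -/
abbrev Map (X Y : FinGSet G) : Type u := X →[G] Y

/-- The identity map. -/
abbrev idm (X : FinGSet G) : Map X X := MulActionHom.id G

/-- The empty `G`-set. -/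
def empty : FinGSet G where
  carrier := PEmpty.{u + 1}
  action :=
    { smul := fun _ x => x
      one_smul := fun _ => rfl
      mul_smul := fun _ _ _ => rfl }

/-- The one-point `G`-set. -/
def point : FinGSet G where
  carrier := PUnit.{u + 1}

/-- The disjoint union. -/
def sum (X Y : FinGSet G) : FinGSet G where
  carrier := X.carrier ⊕ Y.carrier

/-- The cartesian product, with the diagonal action. -/
def prod (X Y : FinGSet G) : FinGSet G where
  carrier := X.carrier × Y.carrier

/-- The map from the empty `G`-set. -/
def fromEmpty (X : FinGSet G) : Map empty X where
  toFun := PEmpty.elim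
  map_smul' := fun _ x => x.elim

/-- The map to the point. -/
def toPoint (X : FinGSet G) : Map X point where
  toFun := fun _ => PUnit.unit
  map_smul' := fun _ _ => rfl

def inl (X Y : FinGSet G) : Map X (X.sum Y) where
  toFun := Sum.inl
  map_smul' := fun _ _ => rfl

def inr (X Y : FinGSet G) : Map Y (X.sum Y) where
  toFun := Sum.inr
  map_smul' := fun _ _ => rfl

def sumMap {X Y X' Y' : FinGSet G} (f : Map X X') (g : Map Y Y') :
    Map (X.sum Y) (X'.sum Y') where
  toFun := Sum.map f g
  map_smul' := by
    rintro c (x | y)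
    · exact congrArg Sum.inl (map_smul f c x)
    · exact congrArg Sum.inr (map_smul g c y)

/-- The codiagonal, which is the identity on both copies of `X`. -/
def fold (X : FinGSet G) : Map (X.sum X) X where
  toFun := Sum.elim id id
  map_smul' := by rintro c (x | x) <;> rfl

def fst (X Y : FinGSet G) : Map (X.prod Y) X where
  toFun := Prod.fst
  map_smul' := fun _ _ => rfl

def snd (X Y : FinGSet G) : Map (X.prod Y) Y where
  toFun := Prod.snd
  map_smul' := fun _ _ => rfl

def prodMap {X Y X' Y' : FinGSet G} (f : Map X X') (g : Map Y Y') :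
    Map (X.prod Y) (X'.prod Y') where
  toFun := Prod.map f g
  map_smul' := fun c x => Prod.ext (map_smul f c x.1) (map_smul g c x.2)

/-- The diagonal. -/
def diag (X : FinGSet G) : Map X (X.prod X) where
  toFun := fun x => (x, x)
  map_smul' := fun _ _ => rfl

/-- The bijection `(X × Y) × Z → X × (Y × Z)`. -/
def assoc (X Y Z : FinGSet G) : Map ((X.prod Y).prod Z) (X.prod (Y.prod Z)) where
  toFun := fun x => (x.1.1, (x.1.2, x.2))
  map_smul' := fun _ _ => rfl

/-- The square
```
  W --f--> X
  |g       |h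
  v        v
  Y --k--> Z
```
commutes and is cartesian. -/
def IsCartesian {W X Y Z : FinGSet G} (f : Map W X) (g : Map W Y) (h : Map X Z)
    (k : Map Y Z) : Prop :=
  (∀ v : W, h (f v) = k (g v)) ∧ ∀ (x : X) (y : Y), h x = k y → ∃! v : W, f v = x ∧ g v = y

section Distributor

variable {X Y Z : FinGSet G} (g : Map X Y) (h : Map Y Z)

/-- Pairs `(z, s)` where `z ∈ Z` and `s : h⁻¹{z} → X` satisfies `g s = 1`. -/
@[ext]
structure DistB where
  base : Z
  sec : {y : Y // h y = base} → X
  sec_spec : ∀ y, g (sec y) = y.1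

variable {g h}

theorem DistB.ext' {b b' : DistB g h} (h1 : b.base = b'.base)
    (h2 : ∀ y (e : h y = b.base) (e' : h y = b'.base), b.sec ⟨y, e⟩ = b'.sec ⟨y, e'⟩) :
    b = b' := by
  obtain ⟨z, s, hs⟩ := b
  obtain ⟨z', s', hs'⟩ := b'
  obtain rfl : z = z' := h1
  obtain rfl : s = s' := funext fun y => h2 y.1 y.2 y.2
  rfl

theorem DistB.sec_congr (b : DistB g h) {y y' : Y} (e : h y = b.base) (e' : h y' = b.base)
    (hy : y = y') : b.sec ⟨y, e⟩ = b.sec ⟨y', e'⟩ := by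
  subst hy
  rfl

/-- The action `γ (z, s) = (γ z, y ↦ γ s(γ⁻¹ y))`. -/
instance : MulAction G (DistB g h) where
  smul c b :=
    { base := c • b.base
      sec := fun y => c • b.sec ⟨c⁻¹ • y.1, by rw [map_smul, y.2, inv_smul_smul]⟩
      sec_spec := fun y => by rw [map_smul, b.sec_spec, smul_inv_smul] }
  one_smul b := DistB.ext' (one_smul G b.base) fun y e e' =>
    (one_smul G _).trans (b.sec_congr _ _ (by rw [inv_one, one_smul]))
  mul_smul c d b := DistB.ext' (mul_smul c d b.base) fun y e e' =>
    (mul_smul c d _).trans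
      (congrArg (fun t => c • d • t) (b.sec_congr _ _ (by rw [mul_inv_rev, mul_smul])))

instance : Finite (DistB g h) := by
  classical
  apply Finite.of_injective (β := Z.carrier × (Y.carrier → Option X.carrier))
    (fun b : DistB g h =>
      (b.base, fun y => if e : h y = b.base then some (b.sec ⟨y, e⟩) else none))
  intro b b' hb
  simp only [Prod.mk.injEq] at hb
  refine DistB.ext' hb.1 fun y e e' => ?_
  have := congrFun hb.2 y
  simpa only [dif_pos e, dif_pos e', Option.some.injEq] using this

variable (g h)

/-- The `G`-set `B` in the distributor `Δ(g, h) = (X ←p A →q B →r Z)`. -/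
def distB : FinGSet G where
  carrier := DistB g h

/-- The `G`-set `A = Y ×_Z B` in the distributor. -/
def distA : FinGSet G where
  carrier := {a : Y.carrier × DistB g h // h a.1 = a.2.base}
  action :=
    { smul := fun c a => ⟨c • a.1, (map_smul h c a.1.1).trans (congrArg (c • ·) a.2)⟩
      one_smul := fun a => Subtype.ext (one_smul G a.1)
      mul_smul := fun c d a => Subtype.ext (mul_smul c d a.1) }

/-- `p(y, s) = s(y)`. -/
def distP : Map (distA g h) X where
  toFun := fun a => a.1.2.sec ⟨a.1.1, a.2⟩
  map_smul' := fun c a => congrArg (c • ·)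
    (a.1.2.sec_congr _ _ (inv_smul_smul c a.1.1))

/-- `q(y, s) = (h(y), s)`. -/
def distQ : Map (distA g h) (distB g h) where
  toFun := fun a => a.1.2
  map_smul' := fun _ _ => rfl

/-- `r(z, s) = z`. -/
def distR : Map (distB g h) Z where
  toFun := fun b => b.base
  map_smul' := fun _ _ => rfl

end Distributor

section OffDiagonal

variable {X Y : FinGSet G} (f : Map X Y)

/-- `F(f) = {(x, x') ∈ X² : x ≠ x', f(x) = f(x')}`. -/
def offDiag : FinGSet G where
  carrier := {x : X.carrier × X.carrier // x.1 ≠ x.2 ∧ f x.1 = f x.2}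
  action :=
    { smul := fun c x => ⟨c • x.1, fun e => x.2.1 (smul_left_cancel c e), by
        change f (c • x.1.1) = f (c • x.1.2)
        rw [map_smul, map_smul, x.2.2]⟩
      one_smul := fun x => Subtype.ext (one_smul G x.1)
      mul_smul := fun c d x => Subtype.ext (mul_smul c d x.1) }

/-- `π(x, x') = x`. -/
def offFst : Map (offDiag f) X where
  toFun := fun x => x.1.1
  map_smul' := fun _ _ => rfl

/-- `π'(x, x') = x'`. -/
def offSnd : Map (offDiag f) X where
  toFun := fun x => x.1.2
  map_smul' := fun _ _ => rfl

end OffDiagonal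

end FinGSet

open FinGSet

/-- A Mackey functor: a product-preserving set-valued functor on the category of spans of finite
`G`-sets. Such a functor consists of restrictions `R` and transfers `T`, functorial, compatible
with cartesian squares, and such that the restrictions turn finite disjoint unions into products.
No additive inverses are required. -/
structure MackeyFunctor (G : Type u) [Group G] where
  obj : FinGSet G → Type w
  R : ∀ {X Y : FinGSet G}, Map X Y → obj Y → obj X
  T : ∀ {X Y : FinGSet G}, Map X Y → obj X → obj Y
  R_id : ∀ {X : FinGSet G} (a : obj X), R (idm X) a = a
  T_id : ∀ {X : FinGSet G} (a : obj X), T (idm X) a = a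
  R_comp : ∀ {X Y Z : FinGSet G} (g : Map Y Z) (f : Map X Y) (a : obj Z),
    R (g.comp f) a = R f (R g a)
  T_comp : ∀ {X Y Z : FinGSet G} (g : Map Y Z) (f : Map X Y) (a : obj X),
    T (g.comp f) a = T g (T f a)
  T_R : ∀ {W X Y Z : FinGSet G} {f : Map W X} {g : Map W Y} {h : Map X Z} {k : Map Y Z},
    IsCartesian f g h k → ∀ a : obj X, T g (R f a) = R k (T h a)
  nonempty_empty : Nonempty (obj FinGSet.empty)
  subsingleton_empty : Subsingleton (obj FinGSet.empty)
  bijective_sum : ∀ X Y : FinGSet G,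
    Function.Bijective fun a : obj (X.sum Y) => (R (inl X Y) a, R (inr X Y) a)

namespace MackeyFunctor

variable {G : Type u} [Group G]

/-- Morphisms of Mackey functors. -/
@[ext]
structure Hom (M N : MackeyFunctor.{u, w} G) where
  app : ∀ X : FinGSet G, M.obj X → N.obj X
  app_R : ∀ {X Y : FinGSet G} (f : Map X Y) (a : M.obj Y), app X (M.R f a) = N.R f (app Y a)
  app_T : ∀ {X Y : FinGSet G} (f : Map X Y) (a : M.obj X), app Y (M.T f a) = N.T f (app X a)

instance : Category (MackeyFunctor.{u, w} G) where
  Hom := Hom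
  id M := ⟨fun _ a => a, fun _ _ => rfl, fun _ _ => rfl⟩
  comp f g := ⟨fun X a => g.app X (f.app X a), fun k a => by rw [f.app_R, g.app_R],
    fun k a => by rw [f.app_T, g.app_T]⟩

section Addition

variable (M : MackeyFunctor.{u, w} G)

/-- The element of `M(X ⊔ Y)` that corresponds to `(a, b) ∈ M(X) × M(Y)`. -/
noncomputable def pair {X Y : FinGSet G} (a : M.obj X) (b : M.obj Y) : M.obj (X.sum Y) :=
  (Equiv.ofBijective _ (M.bijective_sum X Y)).symm (a, b)

/-- `a + b = T_s(a, b)`, where `s` is the codiagonal. -/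
noncomputable def add {X : FinGSet G} (a b : M.obj X) : M.obj X :=
  M.T (fold X) (M.pair a b)

/-- `0 = T_z()`, where `z` is the map from the empty set. -/
noncomputable def zero (X : FinGSet G) : M.obj X :=
  M.T (fromEmpty X) (Classical.choice M.nonempty_empty)

variable {M} {W X Y Z : FinGSet G}

theorem sum_ext {a b : M.obj (X.sum Y)} (h1 : M.R (inl X Y) a = M.R (inl X Y) b)
    (h2 : M.R (inr X Y) a = M.R (inr X Y) b) : a = b :=
  (M.bijective_sum X Y).1 (Prod.ext h1 h2)

theorem R_inl_pair (a : M.obj X) (b : M.obj Y) : M.R (inl X Y) (M.pair a b) = a :=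
  congrArg Prod.fst ((Equiv.ofBijective _ (M.bijective_sum X Y)).apply_symm_apply (a, b))

theorem R_inr_pair (a : M.obj X) (b : M.obj Y) : M.R (inr X Y) (M.pair a b) = b :=
  congrArg Prod.snd ((Equiv.ofBijective _ (M.bijective_sum X Y)).apply_symm_apply (a, b))

theorem app_pair {N : MackeyFunctor.{u, w} G} (φ : Hom M N) (a : M.obj X) (b : M.obj Y) :
    φ.app _ (M.pair a b) = N.pair (φ.app _ a) (φ.app _ b) := by
  apply sum_ext
  · rw [← φ.app_R, R_inl_pair, R_inl_pair]
  · rw [← φ.app_R, R_inr_pair, R_inr_pair]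

theorem app_add {N : MackeyFunctor.{u, w} G} (φ : Hom M N) (a b : M.obj X) :
    φ.app _ (M.add a b) = N.add (φ.app _ a) (φ.app _ b) := by
  rw [add, φ.app_T, app_pair, add]

theorem app_zero {N : MackeyFunctor.{u, w} G} (φ : Hom M N) (X : FinGSet G) :
    φ.app _ (M.zero X) = N.zero X := by
  have := N.subsingleton_empty
  rw [zero, φ.app_T, zero]
  congr 1
  exact Subsingleton.elim _ _

theorem R_sumMap_pair {X' Y' : FinGSet G} (f : Map X X') (g : Map Y Y') (a : M.obj X')
    (b : M.obj Y') : M.R (sumMap f g) (M.pair a b) = M.pair (M.R f a) (M.R g b) := by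
  apply sum_ext
  · rw [R_inl_pair, ← M.R_comp]
    rw [show (sumMap f g).comp (inl X Y) = (inl X' Y').comp f from rfl, M.R_comp, R_inl_pair]
  · rw [R_inr_pair, ← M.R_comp]
    rw [show (sumMap f g).comp (inr X Y) = (inr X' Y').comp g from rfl, M.R_comp, R_inr_pair]

theorem isCartesian_inl {X' Y' : FinGSet G} (f : Map X X') (g : Map Y Y') :
    IsCartesian (inl X Y) f (sumMap f g) (inl X' Y') := by
  refine ⟨fun _ => rfl, ?_⟩
  rintro (x | y) x' h
  · have h' : f x = x' := Sum.inl.inj h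
    exact ⟨x, ⟨rfl, h'⟩, fun v hv => Sum.inl.inj hv.1⟩
  · cases h

theorem isCartesian_inr {X' Y' : FinGSet G} (f : Map X X') (g : Map Y Y') :
    IsCartesian (inr X Y) g (sumMap f g) (inr X' Y') := by
  refine ⟨fun _ => rfl, ?_⟩
  rintro (x | y) x' h
  · cases h
  · have h' : g y = x' := Sum.inr.inj h
    exact ⟨y, ⟨rfl, h'⟩, fun v hv => Sum.inr.inj hv.1⟩

theorem T_sumMap_pair {X' Y' : FinGSet G} (f : Map X X') (g : Map Y Y') (a : M.obj X)
    (b : M.obj Y) : M.T (sumMap f g) (M.pair a b) = M.pair (M.T f a) (M.T g b) := by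
  apply sum_ext
  · rw [R_inl_pair, ← M.T_R (isCartesian_inl f g), R_inl_pair]
  · rw [R_inr_pair, ← M.T_R (isCartesian_inr f g), R_inr_pair]

theorem R_fold (a : M.obj X) : M.R (fold X) a = M.pair a a := by
  apply sum_ext
  · rw [R_inl_pair, ← M.R_comp]
    exact M.R_id a
  · rw [R_inr_pair, ← M.R_comp]
    exact M.R_id a

theorem T_add (f : Map X Y) (a b : M.obj X) : M.T f (M.add a b) = M.add (M.T f a) (M.T f b) := by
  rw [add, add, ← T_sumMap_pair, ← M.T_comp, ← M.T_comp]
  congr 1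
  ext (x | x) <;> rfl

theorem T_zero (f : Map X Y) : M.T f (M.zero X) = M.zero Y := by
  rw [zero, zero, ← M.T_comp]
  congr 1
  ext x
  exact x.elim

theorem R_add (f : Map X Y) (a b : M.obj Y) : M.R f (M.add a b) = M.add (M.R f a) (M.R f b) := by
  rw [add, add, ← R_sumMap_pair]
  refine (M.T_R ⟨?_, ?_⟩ _).symm
  · rintro (v | v) <;> rfl
  · rintro (y | y) x h
    · refine ⟨Sum.inl x, ⟨congrArg Sum.inl (Eq.symm h), rfl⟩, ?_⟩
      rintro (v | v) ⟨h1, h2⟩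
      · exact congrArg Sum.inl h2
      · cases h1
    · refine ⟨Sum.inr x, ⟨congrArg Sum.inr (Eq.symm h), rfl⟩, ?_⟩
      rintro (v | v) ⟨h1, h2⟩
      · cases h1
      · exact congrArg Sum.inr h2

theorem R_zero (f : Map X Y) : M.R f (M.zero Y) = M.zero X := by
  have := M.subsingleton_empty
  rw [zero, zero, ← M.T_R (f := idm _) (g := fromEmpty X)
    (h := fromEmpty Y) (k := f) ⟨fun v => v.elim, fun v => v.elim⟩]
  congr 1
  exact Subsingleton.elim _ _

theorem add_zero' (a : M.obj X) : M.add a (M.zero X) = a := by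
  have h : M.pair a (M.zero X) = M.T (inl X X) a := by
    have := M.subsingleton_empty
    apply sum_ext
    · rw [R_inl_pair, ← M.T_R (f := idm X) (g := idm X), M.T_id, M.R_id]
      exact ⟨fun _ => rfl, fun x y h => ⟨x, ⟨rfl, Sum.inl.inj h⟩, fun v hv => hv.1⟩⟩
    · rw [R_inr_pair, ← M.T_R (f := fromEmpty X) (g := fromEmpty X), zero]
      · congr 1
        exact Subsingleton.elim _ _
      · exact ⟨fun v => v.elim, fun x y h => by cases h⟩
  rw [add, h, ← M.T_comp]
  exact M.T_id a

/-- The bijection that exchanges the two copies of `X`. -/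
def swap (X : FinGSet G) : Map (X.sum X) (X.sum X) where
  toFun := Sum.swap
  map_smul' := by rintro c (x | x) <;> rfl

theorem add_comm' (a b : M.obj X) : M.add a b = M.add b a := by
  have h : M.pair b a = M.T (swap X) (M.pair a b) := by
    apply sum_ext
    · rw [R_inl_pair, ← M.T_R (f := inr X X) (g := idm X), R_inr_pair, M.T_id]
      refine ⟨fun _ => rfl, ?_⟩
      rintro (x | x) y h
      · cases h
      · exact ⟨x, ⟨rfl, Sum.inl.inj h⟩, fun v hv => Sum.inr.inj hv.1⟩
    · rw [R_inr_pair, ← M.T_R (f := inl X X) (g := idm X), R_inl_pair, M.T_id]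
      refine ⟨fun _ => rfl, ?_⟩
      rintro (x | x) y h
      · exact ⟨x, ⟨rfl, Sum.inr.inj h⟩, fun v hv => Sum.inl.inj hv.1⟩
      · cases h
  rw [add, add, h, ← M.T_comp]
  congr 1
  ext (x | x) <;> rfl

theorem add_exchange (a b c d : M.obj X) :
    M.add (M.add a b) (M.add c d) = M.add (M.add a c) (M.add b d) := by
  have h : M.add (M.pair a b) (M.pair c d) = M.pair (M.add a c) (M.add b d) := by
    apply sum_ext
    · rw [R_add, R_inl_pair, R_inl_pair, R_inl_pair]
    · rw [R_add, R_inr_pair, R_inr_pair, R_inr_pair]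
  rw [show M.add a b = M.T (fold X) (M.pair a b) from rfl,
    show M.add c d = M.T (fold X) (M.pair c d) from rfl, ← T_add, h]
  rfl

theorem add_assoc' (a b c : M.obj X) : M.add (M.add a b) c = M.add a (M.add b c) := by
  conv_lhs => rw [← add_zero' c, add_comm' c, add_exchange, add_zero']

/-- The canonical semigroup structure on `M(X)`. -/
noncomputable instance (M : MackeyFunctor.{u, w} G) (X : FinGSet G) : AddCommMonoid (M.obj X) where
  add := M.add
  zero := M.zero X
  add_assoc := add_assoc'
  zero_add a := (add_comm' _ a).trans (add_zero' a)
  add_zero := add_zero'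
  add_comm := add_comm'
  nsmul := @nsmulRec _ ⟨M.zero X⟩ ⟨M.add⟩

end Addition

/-- The direct sum of Mackey functors. -/
def directSum (M N : MackeyFunctor.{u, w} G) : MackeyFunctor.{u, w} G where
  obj X := M.obj X × N.obj X
  R f a := (M.R f a.1, N.R f a.2)
  T f a := (M.T f a.1, N.T f a.2)
  R_id a := Prod.ext (M.R_id _) (N.R_id _)
  T_id a := Prod.ext (M.T_id _) (N.T_id _)
  R_comp g f a := Prod.ext (M.R_comp _ _ _) (N.R_comp _ _ _)
  T_comp g f a := Prod.ext (M.T_comp _ _ _) (N.T_comp _ _ _)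
  T_R h a := Prod.ext (M.T_R h _) (N.T_R h _)
  nonempty_empty := ⟨(Classical.choice M.nonempty_empty, Classical.choice N.nonempty_empty)⟩
  subsingleton_empty := by
    have := M.subsingleton_empty
    have := N.subsingleton_empty
    exact inferInstanceAs (Subsingleton (_ × _))
  bijective_sum X Y := by
    constructor
    · intro a b h
      simp only [Prod.mk.injEq] at h
      exact Prod.ext (sum_ext h.1.1 h.2.1) (sum_ext h.1.2 h.2.2)
    · rintro ⟨⟨a, a'⟩, ⟨b, b'⟩⟩
      exact ⟨(M.pair a b, N.pair a' b'), by simp only [R_inl_pair, R_inr_pair]⟩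

end MackeyFunctor

/-- A Tambara functor: a product-preserving set-valued functor on the category of bispans of finite
`G`-sets. Such a functor consists of restrictions `R`, transfers `T` and norms `N`, functorial,
compatible with cartesian squares and with distributors, and such that the restrictions turn
finite disjoint unions into products. -/
structure TambaraFunctor (G : Type u) [Group G] extends MackeyFunctor.{u, w} G where
  N : ∀ {X Y : FinGSet G}, Map X Y → obj X → obj Y
  N_id : ∀ {X : FinGSet G} (a : obj X), N (idm X) a = a
  N_comp : ∀ {X Y Z : FinGSet G} (g : Map Y Z) (f : Map X Y) (a : obj X),
    N (g.comp f) a = N g (N f a)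
  N_R : ∀ {W X Y Z : FinGSet G} {f : Map W X} {g : Map W Y} {h : Map X Z} {k : Map Y Z},
    IsCartesian f g h k → ∀ a : obj X, N g (R f a) = R k (N h a)
  N_T : ∀ {X Y Z : FinGSet G} (g : Map X Y) (h : Map Y Z) (a : obj X),
    N h (T g a) = T (distR g h) (N (distQ g h) (R (distP g h) a))

namespace TambaraFunctor

variable {G : Type u} [Group G]

/-- Morphisms of Tambara functors. -/
@[ext]
structure Hom (S T : TambaraFunctor.{u, w} G) extends
    MackeyFunctor.Hom S.toMackeyFunctor T.toMackeyFunctor where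
  app_N : ∀ {X Y : FinGSet G} (f : Map X Y) (a : S.obj X), app Y (S.N f a) = T.N f (app X a)

instance : Category (TambaraFunctor.{u, w} G) where
  Hom := Hom
  id M := { app := fun _ a => a, app_R := fun _ _ => rfl, app_T := fun _ _ => rfl,
            app_N := fun _ _ => rfl }
  comp f g :=
    { app := fun X a => g.app X (f.app X a)
      app_R := fun k a => by rw [f.app_R, g.app_R]
      app_T := fun k a => by rw [f.app_T, g.app_T]
      app_N := fun k a => by rw [f.app_N, g.app_N] }

/-- The Mackey functor with the same restrictions and with the norms as transfers. Its addition
is the multiplication of `S`. -/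
def normMackey (S : TambaraFunctor.{u, w} G) : MackeyFunctor.{u, w} G where
  obj := S.obj
  R := S.R
  T := S.N
  R_id := S.R_id
  T_id := S.N_id
  R_comp := S.R_comp
  T_comp := S.N_comp
  T_R := S.N_R
  nonempty_empty := S.nonempty_empty
  subsingleton_empty := S.subsingleton_empty
  bijective_sum := S.bijective_sum

section Multiplication

variable (S : TambaraFunctor.{u, w} G)

/-- `a b = N_s(a, b)`, where `s` is the codiagonal. -/
noncomputable def mul {X : FinGSet G} (a b : S.obj X) : S.obj X :=
  S.N (fold X) (S.pair a b)

/-- `1 = N_z()`, where `z` is the map from the empty set. -/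
noncomputable def one (X : FinGSet G) : S.obj X :=
  S.N (fromEmpty X) (Classical.choice S.nonempty_empty)

variable {S} {W X Y Z : FinGSet G}

theorem mul_def (a b : S.obj X) : S.mul a b = S.normMackey.add a b := rfl

theorem one_def (X : FinGSet G) : S.one X = S.normMackey.zero X := rfl

theorem isCartesian_of_bijective {f : Map X Y} (hf : Function.Bijective f) :
    IsCartesian f f (idm Y) (idm Y) := by
  refine ⟨fun _ => rfl, fun x y h => ?_⟩
  obtain ⟨v, rfl⟩ := hf.2 x
  exact ⟨v, ⟨rfl, h⟩, fun v' hv => hf.1 hv.1⟩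

theorem T_R_of_bijective {f : Map X Y} (hf : Function.Bijective f) (a : S.obj Y) :
    S.T f (S.R f a) = a := by
  rw [S.T_R (isCartesian_of_bijective hf), S.R_id, S.T_id]

theorem N_R_of_bijective {f : Map X Y} (hf : Function.Bijective f) (a : S.obj Y) :
    S.N f (S.R f a) = a := by
  rw [S.N_R (isCartesian_of_bijective hf), S.R_id, S.N_id]

theorem isCartesian_self {f : Map X Y} (hf : Function.Injective f) :
    IsCartesian (idm X) (idm X) f f :=
  ⟨fun _ => rfl, fun x _ h => ⟨x, ⟨rfl, hf h⟩, fun _ hv => hv.1⟩⟩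

theorem T_eq_N_of_bijective {f : Map X Y} (hf : Function.Bijective f) (a : S.obj X) :
    S.T f a = S.N f a := by
  have h : S.R f (S.T f a) = a := by
    rw [← S.T_R (isCartesian_self hf.1), S.R_id, S.T_id]
  conv_rhs => rw [← h, N_R_of_bijective hf]

/-- Frobenius reciprocity. -/
theorem T_mul_R (f : Map X Y) (a : S.obj X) (b : S.obj Y) :
    S.T f (S.mul a (S.R f b)) = S.mul (S.T f a) b := by
  let g : Map (X.sum Y) (Y.sum Y) := sumMap f (idm Y)
  let h : Map (Y.sum Y) Y := fold Y
  let β : Map X (distB g h) :=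
    { toFun := fun x =>
        { base := f x
          sec := fun y => Sum.elim (fun _ => Sum.inl x) Sum.inr y.1
          sec_spec := by
            rintro ⟨y | y, hy⟩
            · exact congrArg Sum.inl (Eq.symm hy)
            · exact rfl }
      map_smul' := fun c x => DistB.ext' (map_smul f c x) (by
        rintro (y | y) e e'
        · rfl
        · exact congrArg Sum.inr (smul_inv_smul c (y : Y.carrier)).symm) }
  let α : Map (X.sum X) (distA g h) :=
    { toFun := fun x => ⟨(sumMap f f x, β (fold X x)), by rcases x with x | x <;> rfl⟩
      map_smul' := fun c x => Subtype.ext (Prod.ext (map_smul (sumMap f f) c x)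
        ((congrArg β (map_smul (fold X) c x)).trans (map_smul β c _))) }
  have key : ∀ (b : DistB g h) (y : Y) (e : h (Sum.inl y) = b.base),
      ∃ x : X, f x = y ∧ b.sec ⟨Sum.inl y, e⟩ = Sum.inl x := by
    intro b y e
    have hs := b.sec_spec ⟨Sum.inl y, e⟩
    rcases hb : b.sec ⟨Sum.inl y, e⟩ with x | y'
    · rw [hb] at hs
      exact ⟨x, Sum.inl.inj hs, rfl⟩
    · rw [hb] at hs
      cases hs
  have hβ : Function.Bijective β := by
    constructor
    · intro x x' hx
      have h1 : f x = f x' := congrArg DistB.base hx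
      have h2 : ∀ b : DistB g h, b = β x → ∀ e : h (Sum.inl (f x')) = b.base,
          b.sec ⟨Sum.inl (f x'), e⟩ = Sum.inl x := by
        rintro _ rfl e
        rfl
      exact Sum.inl.inj ((h2 (β x') hx.symm rfl).symm.trans rfl)
    · intro b
      obtain ⟨x, hx, hb⟩ := key b b.base rfl
      refine ⟨x, DistB.ext' hx ?_⟩
      rintro (y | y) e e'
      · have hy : y = b.base := e'
        subst hy
        exact hb.symm
      · have hs := b.sec_spec ⟨Sum.inr y, e'⟩
        rcases hb' : b.sec ⟨Sum.inr y, e'⟩ with x' | y'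
        · rw [hb'] at hs
          cases hs
        · rw [hb'] at hs
          exact congrArg Sum.inr (Sum.inr.inj hs).symm
  have hα : Function.Bijective α := by
    constructor
    · rintro (x | x) (x' | x') hx
      · exact congrArg Sum.inl (hβ.1 (congrArg (fun a => a.1.2) hx))
      · cases congrArg (fun a => a.1.1) hx
      · cases congrArg (fun a => a.1.1) hx
      · exact congrArg Sum.inr (hβ.1 (congrArg (fun a => a.1.2) hx))
    · rintro ⟨⟨y | y, b⟩, hb⟩
      · obtain ⟨x, rfl⟩ := hβ.2 b
        have hy : y = f x := hb
        subst hy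
        exact ⟨Sum.inl x, rfl⟩
      · obtain ⟨x, rfl⟩ := hβ.2 b
        have hy : y = f x := hb
        subst hy
        exact ⟨Sum.inr x, rfl⟩
  have hl : S.mul (S.T f a) b = S.N h (S.T g (S.pair a b)) := by
    rw [MackeyFunctor.T_sumMap_pair, S.T_id]
    rfl
  have hr : S.mul a (S.R f b) = S.N (fold X) (S.R α (S.R (distP g h) (S.pair a b))) := by
    have : (distP g h).comp α = sumMap (idm X) f := by
      ext (x | x) <;> rfl
    rw [← S.R_comp, this, MackeyFunctor.R_sumMap_pair, S.R_id]
    rfl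
  rw [hl, S.N_T, hr, show f = (distR g h).comp β from rfl, S.T_comp, T_eq_N_of_bijective hβ,
    ← S.N_comp, show β.comp (fold X) = (distQ g h).comp α from rfl, S.N_comp, N_R_of_bijective hα]

theorem right_distrib' (a b c : S.obj X) :
    S.mul (S.add a b) c = S.add (S.mul a c) (S.mul b c) := by
  rw [MackeyFunctor.add, ← T_mul_R, MackeyFunctor.R_fold, MackeyFunctor.add]
  congr 1
  apply MackeyFunctor.sum_ext
  · rw [MackeyFunctor.R_inl_pair]
    refine (MackeyFunctor.R_add (M := S.normMackey) _ _ _).trans ?_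
    change S.mul (S.R (inl X X) (S.pair a b)) (S.R (inl X X) (S.pair c c)) = _
    rw [MackeyFunctor.R_inl_pair, MackeyFunctor.R_inl_pair]
  · rw [MackeyFunctor.R_inr_pair]
    refine (MackeyFunctor.R_add (M := S.normMackey) _ _ _).trans ?_
    change S.mul (S.R (inr X X) (S.pair a b)) (S.R (inr X X) (S.pair c c)) = _
    rw [MackeyFunctor.R_inr_pair, MackeyFunctor.R_inr_pair]

theorem zero_mul' (c : S.obj X) : S.mul (S.zero X) c = S.zero X := by
  have := S.subsingleton_empty
  rw [MackeyFunctor.zero, ← T_mul_R]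
  congr 1
  exact Subsingleton.elim _ _

/-- The canonical semiring structure on `S(X)`. -/
noncomputable instance (S : TambaraFunctor.{u, w} G) (X : FinGSet G) : CommSemiring (S.obj X) where
  mul := S.mul
  one := S.one X
  mul_assoc := MackeyFunctor.add_assoc' (M := S.normMackey)
  one_mul a := (MackeyFunctor.add_comm' (M := S.normMackey) _ a).trans
    (MackeyFunctor.add_zero' (M := S.normMackey) a)
  mul_one := MackeyFunctor.add_zero' (M := S.normMackey)
  mul_comm := MackeyFunctor.add_comm' (M := S.normMackey)
  right_distrib := right_distrib'
  left_distrib a b c := by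
    have hc : ∀ x y : S.obj X, S.mul x y = S.mul y x :=
      MackeyFunctor.add_comm' (M := S.normMackey)
    exact (hc _ _).trans ((right_distrib' b c a).trans (by rw [hc b a, hc c a]; rfl))
  zero_mul := zero_mul'
  mul_zero a := (MackeyFunctor.add_comm' (M := S.normMackey) a _).trans (zero_mul' a)

end Multiplication

end TambaraFunctor

namespace TambaraFunctor

variable {G : Type u} [Group G]

/-- The underlying Mackey functor of a Tambara functor. -/
def toMackey (G : Type u) [Group G] : TambaraFunctor.{u, w} G ⥤ MackeyFunctor.{u, w} G where
  obj S := S.toMackeyFunctor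
  map f := f.toHom

/-- `S` is additively complete if every element of every `S(X)` has an additive inverse. -/
def AdditivelyComplete (S : TambaraFunctor.{u, w} G) : Prop :=
  ∀ (X : FinGSet G) (a : S.obj X), ∃ b : S.obj X, a + b = 0

theorem Hom.app_add {S T : TambaraFunctor.{u, w} G} (φ : Hom S T) {X : FinGSet G}
    (a b : S.obj X) : φ.app X (a + b) = φ.app X a + φ.app X b :=
  MackeyFunctor.app_add φ.toHom a b

theorem Hom.app_zero {S T : TambaraFunctor.{u, w} G} (φ : Hom S T) (X : FinGSet G) :
    φ.app X 0 = 0 :=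
  MackeyFunctor.app_zero φ.toHom X

/-- A morphism of Tambara functors is a morphism for the multiplicative structure. -/
def Hom.norm {S T : TambaraFunctor.{u, w} G} (φ : Hom S T) :
    MackeyFunctor.Hom S.normMackey T.normMackey where
  app := φ.app
  app_R := φ.app_R
  app_T := φ.app_N

theorem Hom.app_mul {S T : TambaraFunctor.{u, w} G} (φ : Hom S T) {X : FinGSet G}
    (a b : S.obj X) : φ.app X (a * b) = φ.app X a * φ.app X b :=
  MackeyFunctor.app_add φ.norm a b

theorem Hom.app_one {S T : TambaraFunctor.{u, w} G} (φ : Hom S T) (X : FinGSet G) :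
    φ.app X 1 = 1 :=
  MackeyFunctor.app_zero φ.norm X

theorem R_mul (S : TambaraFunctor.{u, w} G) {X Y : FinGSet G} (f : Map X Y) (a b : S.obj Y) :
    S.R f (a * b) = S.R f a * S.R f b :=
  MackeyFunctor.R_add (M := S.normMackey) f a b

theorem R_one (S : TambaraFunctor.{u, w} G) {X Y : FinGSet G} (f : Map X Y) :
    S.R f 1 = 1 :=
  MackeyFunctor.R_zero (M := S.normMackey) f

/-- The external product `S(X) × S(Y) → S(X × Y)`, `(a, b) ↦ R_p(a) R_q(b)`, where `p` and `q` are
the projections. It corresponds to the multiplication map `S □ S → S`. -/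
noncomputable def extMul (S : TambaraFunctor.{u, w} G) {X Y : FinGSet G} (a : S.obj X)
    (b : S.obj Y) : S.obj (X.prod Y) :=
  S.R (fst X Y) a * S.R (snd X Y) b

/-- The fibre product of Tambara functors. -/
def fibreProd {S T T' : TambaraFunctor.{u, w} G} (ε : Hom T S) (ε' : Hom T' S) :
    TambaraFunctor.{u, w} G where
  obj X := {a : T.obj X × T'.obj X // ε.app X a.1 = ε'.app X a.2}
  R f a := ⟨(T.R f a.1.1, T'.R f a.1.2), by rw [ε.app_R, ε'.app_R, a.2]⟩
  T f a := ⟨(T.T f a.1.1, T'.T f a.1.2), by rw [ε.app_T, ε'.app_T, a.2]⟩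
  N f a := ⟨(T.N f a.1.1, T'.N f a.1.2), by rw [ε.app_N, ε'.app_N, a.2]⟩
  R_id a := Subtype.ext (Prod.ext (T.R_id _) (T'.R_id _))
  T_id a := Subtype.ext (Prod.ext (T.T_id _) (T'.T_id _))
  N_id a := Subtype.ext (Prod.ext (T.N_id _) (T'.N_id _))
  R_comp g f a := Subtype.ext (Prod.ext (T.R_comp _ _ _) (T'.R_comp _ _ _))
  T_comp g f a := Subtype.ext (Prod.ext (T.T_comp _ _ _) (T'.T_comp _ _ _))
  N_comp g f a := Subtype.ext (Prod.ext (T.N_comp _ _ _) (T'.N_comp _ _ _))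
  T_R h a := Subtype.ext (Prod.ext (T.T_R h _) (T'.T_R h _))
  N_R h a := Subtype.ext (Prod.ext (T.N_R h _) (T'.N_R h _))
  N_T g h a := Subtype.ext (Prod.ext (T.N_T g h _) (T'.N_T g h _))
  nonempty_empty := by
    have := S.subsingleton_empty
    exact ⟨⟨(Classical.choice T.nonempty_empty, Classical.choice T'.nonempty_empty),
      Subsingleton.elim _ _⟩⟩
  subsingleton_empty := by
    have := T.subsingleton_empty
    have := T'.subsingleton_empty
    exact inferInstanceAs (Subsingleton {a : _ × _ // _})
  bijective_sum X Y := by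
    constructor
    · intro a b h
      simp only [Prod.mk.injEq, Subtype.mk.injEq] at h
      exact Subtype.ext (Prod.ext (MackeyFunctor.sum_ext h.1.1 h.2.1)
        (MackeyFunctor.sum_ext h.1.2 h.2.2))
    · rintro ⟨⟨⟨a, a'⟩, ha⟩, ⟨⟨b, b'⟩, hb⟩⟩
      refine ⟨⟨(T.pair a b, T'.pair a' b'), ?_⟩, ?_⟩
      · exact (MackeyFunctor.app_pair ε.toHom a b).trans
          ((congrArg₂ S.pair ha hb).trans (MackeyFunctor.app_pair ε'.toHom a' b').symm)
      · simp only [MackeyFunctor.R_inl_pair, MackeyFunctor.R_inr_pair]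

end TambaraFunctor

/-- An augmented `S`-algebra: a Tambara functor `T` with morphisms `η : S → T` and `ε : T → S`
such that `ε η = 1`. -/
structure AugAlg {G : Type u} [Group G] (S : TambaraFunctor.{u, w} G) where
  tambara : TambaraFunctor.{u, w} G
  η : S ⟶ tambara
  ε : tambara ⟶ S
  η_ε : η ≫ ε = 𝟙 S

namespace AugAlg

variable {G : Type u} [Group G] {S : TambaraFunctor.{u, w} G}

/-- Morphisms of augmented `S`-algebras. -/
@[ext]
structure Hom (T T' : AugAlg S) where
  hom : T.tambara ⟶ T'.tambara
  η_hom : T.η ≫ hom = T'.η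
  hom_ε : hom ≫ T'.ε = T.ε

instance : Category (AugAlg S) where
  Hom := Hom
  id T := ⟨𝟙 _, Category.comp_id _, Category.id_comp _⟩
  comp f g := ⟨f.hom ≫ g.hom, by rw [← Category.assoc, f.η_hom, g.η_hom],
    by rw [Category.assoc, g.hom_ε, f.hom_ε]⟩

theorem ε_η_app (T : AugAlg S) {X : FinGSet G} (a : S.obj X) :
    T.ε.app X (T.η.app X a) = a :=
  congrArg (fun f : TambaraFunctor.Hom S S => f.app X a) T.η_ε

/-- The initial and terminal augmented `S`-algebra `S`. -/
def unit (S : TambaraFunctor.{u, w} G) : AugAlg S := ⟨S, 𝟙 S, 𝟙 S, Category.comp_id _⟩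

/-- The product `T ×_S T'`. -/
def prod (T T' : AugAlg S) : AugAlg S where
  tambara := TambaraFunctor.fibreProd T.ε T'.ε
  η :=
    { app := fun X a => ⟨(T.η.app X a, T'.η.app X a), by rw [ε_η_app, ε_η_app]⟩
      app_R := fun f a => Subtype.ext (Prod.ext (T.η.app_R f a) (T'.η.app_R f a))
      app_T := fun f a => Subtype.ext (Prod.ext (T.η.app_T f a) (T'.η.app_T f a))
      app_N := fun f a => Subtype.ext (Prod.ext (T.η.app_N f a) (T'.η.app_N f a)) }
  ε :=
    { app := fun X a => T.ε.app X a.1.1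
      app_R := fun f a => T.ε.app_R f a.1.1
      app_T := fun f a => T.ε.app_T f a.1.1
      app_N := fun f a => T.ε.app_N f a.1.1 }
  η_ε := TambaraFunctor.Hom.ext (funext fun X => funext fun a => T.ε_η_app a)

def prodFst (T T' : AugAlg S) : prod T T' ⟶ T where
  hom :=
    { app := fun _ a => a.1.1
      app_R := fun _ _ => rfl
      app_T := fun _ _ => rfl
      app_N := fun _ _ => rfl }
  η_hom := rfl
  hom_ε := rfl

def prodSnd (T T' : AugAlg S) : prod T T' ⟶ T' where
  hom :=
    { app := fun _ a => a.1.2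
      app_R := fun _ _ => rfl
      app_T := fun _ _ => rfl
      app_N := fun _ _ => rfl }
  η_hom := rfl
  hom_ε := TambaraFunctor.Hom.ext (funext fun _ => funext fun a => a.2.symm)

def prodLift {T T' U : AugAlg S} (f : U ⟶ T) (g : U ⟶ T') : U ⟶ prod T T' where
  hom :=
    { app := fun X a => ⟨(f.hom.app X a, g.hom.app X a),
        (congrArg (fun k : TambaraFunctor.Hom U.tambara S => k.app X a)
          (f.hom_ε.trans g.hom_ε.symm) :)⟩
      app_R := fun k a => Subtype.ext (Prod.ext (f.hom.app_R k a) (g.hom.app_R k a))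
      app_T := fun k a => Subtype.ext (Prod.ext (f.hom.app_T k a) (g.hom.app_T k a))
      app_N := fun k a => Subtype.ext (Prod.ext (f.hom.app_N k a) (g.hom.app_N k a)) }
  η_hom := TambaraFunctor.Hom.ext (funext fun X => funext fun a => Subtype.ext (Prod.ext
    (congrArg (fun k : TambaraFunctor.Hom S T.tambara => k.app X a) f.η_hom)
    (congrArg (fun k : TambaraFunctor.Hom S T'.tambara => k.app X a) g.η_hom)))
  hom_ε := f.hom_ε

open Limits in
/-- The fibre products over `S` are the products of augmented `S`-algebras. -/
def prodLimitCone (T T' : AugAlg S) : LimitCone (pair T T') where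
  cone := BinaryFan.mk (prodFst T T') (prodSnd T T')
  isLimit := BinaryFan.IsLimit.mk _ (fun f g => prodLift f g) (fun _ _ => rfl) (fun _ _ => rfl)
    (by
      rintro U f g m rfl rfl
      rfl)

open Limits in
/-- `S` is terminal among augmented `S`-algebras. -/
def unitLimitCone (S : TambaraFunctor.{u, w} G) : LimitCone (Functor.empty.{0} (AugAlg S)) where
  cone := asEmptyCone (unit S)
  isLimit := IsTerminal.ofUniqueHom
    (fun T => ⟨T.ε, T.η_ε, Category.comp_id _⟩)
    (fun _ m => Hom.ext ((Category.comp_id _).symm.trans m.hom_ε))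

instance : CartesianMonoidalCategory (AugAlg S) :=
  .ofChosenFiniteProducts (unitLimitCone S) prodLimitCone

instance : BraidedCategory (AugAlg S) := .ofCartesianMonoidalCategory

end AugAlg

/-- The category of `S`-modules: commutative monoid objects in augmented `S`-algebras. -/
abbrev SMod {G : Type u} [Group G] (S : TambaraFunctor.{u, w} G) := CommMon (AugAlg S)

namespace SMod

variable {G : Type u} [Group G] {S : TambaraFunctor.{u, w} G}

/-- The underlying Tambara functor of an `S`-module. -/
abbrev tambara (T : SMod S) : TambaraFunctor.{u, w} G := T.X.tambara

/-- The unit `η : S → T`. -/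
abbrev η (T : SMod S) : S ⟶ T.tambara := T.X.η

/-- The augmentation `ε : T → S`. -/
abbrev ε (T : SMod S) : T.tambara ⟶ S := T.X.ε

/-- The structure map `σ : T ×_S T → T`, on elements. -/
def σ (T : SMod S) {X : FinGSet G} (a b : T.tambara.obj X) (h : T.ε.app X a = T.ε.app X b) :
    T.tambara.obj X :=
  AugAlg.Hom.hom (T := AugAlg.prod T.X T.X) (T' := T.X) (MonObj.mul (X := T.X)) |>.app X ⟨(a, b), h⟩

/-- The functor that takes an `S`-module to its underlying augmented `S`-algebra. -/
abbrev toAugAlg (S : TambaraFunctor.{u, w} G) : SMod S ⥤ AugAlg S := CommMon.forget (AugAlg S)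

/-- The underlying Mackey functor of an `S`-module. -/
def toMackey (S : TambaraFunctor.{u, w} G) : SMod S ⥤ MackeyFunctor.{u, w} G where
  obj T := T.tambara.toMackeyFunctor
  map f := f.hom.hom.hom.toHom

end SMod

/-- A naive `S`-module: a Mackey functor `M` with an associative and unital map `ν : S □ M → M`.
By the universal property of the box product, such a map amounts to maps
`S(X) × M(Y) → M(X × Y)` that are natural with respect to spans in `X` and `Y`. -/
structure NMod {G : Type u} [Group G] (S : TambaraFunctor.{u, w} G) where
  mackey : MackeyFunctor.{u, w} G
  ν : ∀ {X Y : FinGSet G}, S.obj X → mackey.obj Y → mackey.obj (X.prod Y)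
  ν_R : ∀ {X Y X' Y' : FinGSet G} (f : Map X X') (g : Map Y Y') (a : S.obj X')
    (m : mackey.obj Y'), ν (S.R f a) (mackey.R g m) = mackey.R (prodMap f g) (ν a m)
  ν_T : ∀ {X Y X' Y' : FinGSet G} (f : Map X X') (g : Map Y Y') (a : S.obj X)
    (m : mackey.obj Y), ν (S.T f a) (mackey.T g m) = mackey.T (prodMap f g) (ν a m)
  ν_assoc : ∀ {X Y Z : FinGSet G} (a : S.obj X) (b : S.obj Y) (m : mackey.obj Z),
    ν (S.extMul a b) m = mackey.R (assoc X Y Z) (ν a (ν b m))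
  ν_one : ∀ {X : FinGSet G} (m : mackey.obj X),
    ν (1 : S.obj point) m = mackey.R (snd point X) m

namespace NMod

variable {G : Type u} [Group G] {S : TambaraFunctor.{u, w} G}

/-- The internal action `a m = R_δ(ν(a, m))` of `S(X)` on `M(X)`, where `δ` is the diagonal. -/
def act (M : NMod S) {X : FinGSet G} (a : S.obj X) (m : M.mackey.obj X) : M.mackey.obj X :=
  M.mackey.R (diag X) (M.ν a m)

/-- Morphisms of naive `S`-modules. -/
@[ext]
structure Hom (M M' : NMod S) where
  hom : M.mackey ⟶ M'.mackey
  hom_ν : ∀ {X Y : FinGSet G} (a : S.obj X) (m : M.mackey.obj Y),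
    hom.app (X.prod Y) (M.ν a m) = M'.ν a (hom.app Y m)

instance : Category (NMod S) where
  Hom := Hom
  id M := ⟨𝟙 _, fun _ _ => rfl⟩
  comp f g := ⟨f.hom ≫ g.hom, fun a m =>
    (congrArg (g.hom.app _) (f.hom_ν a m)).trans (g.hom_ν a _)⟩

/-- The functor `M ↦ S ⊕ M` from naive `S`-modules to Mackey functors. -/
def addS (S : TambaraFunctor.{u, w} G) : NMod S ⥤ MackeyFunctor.{u, w} G where
  obj M := S.toMackeyFunctor.directSum M.mackey
  map φ :=
    { app := fun X a => (a.1, φ.hom.app X a.2)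
      app_R := fun f a => Prod.ext rfl (φ.hom.app_R f a.2)
      app_T := fun f a => Prod.ext rfl (φ.hom.app_T f a.2) }

/-- The norm map `(a, m) ↦ (N_f(a), T_f(N_π R_π'(a) m))` on `S ⊕ M`, where `π` and `π'` are the
projections to `X` of the set of pairs `(x, x')` with `x ≠ x'` and `f(x) = f(x')`. -/
def norm (M : NMod S) {X Y : FinGSet G} (f : Map X Y) (a : S.obj X × M.mackey.obj X) :
    S.obj Y × M.mackey.obj Y :=
  (S.N f a.1, M.mackey.T f (M.act (S.N (offFst f) (S.R (offSnd f) a.1)) a.2))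

end NMod

section Lambda

variable {G : Type u} [Group G] {S : TambaraFunctor.{u, w} G}

/-- The Mackey functor `(Λ T)(X) = {a ∈ T(X) : ε(a) = 0}`. -/
def AugAlg.kerMackey (T : AugAlg S) : MackeyFunctor.{u, w} G where
  obj X := {a : T.tambara.obj X // T.ε.app X a = 0}
  R f a := ⟨T.tambara.R f a.1, by rw [T.ε.app_R, a.2]; exact MackeyFunctor.R_zero f⟩
  T f a := ⟨T.tambara.T f a.1, by rw [T.ε.app_T, a.2]; exact MackeyFunctor.T_zero f⟩
  R_id a := Subtype.ext (T.tambara.R_id _)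
  T_id a := Subtype.ext (T.tambara.T_id _)
  R_comp g f a := Subtype.ext (T.tambara.R_comp _ _ _)
  T_comp g f a := Subtype.ext (T.tambara.T_comp _ _ _)
  T_R h a := Subtype.ext (T.tambara.T_R h _)
  nonempty_empty := ⟨⟨0, T.ε.app_zero _⟩⟩
  subsingleton_empty := by
    have := T.tambara.subsingleton_empty
    exact inferInstanceAs (Subsingleton {a // _})
  bijective_sum X Y := by
    constructor
    · intro a b h
      simp only [Prod.mk.injEq, Subtype.mk.injEq] at h
      exact Subtype.ext (MackeyFunctor.sum_ext h.1 h.2)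
    · rintro ⟨⟨a, ha⟩, ⟨b, hb⟩⟩
      refine ⟨⟨T.tambara.pair a b, ?_⟩, ?_⟩
      · refine (MackeyFunctor.app_pair T.ε.toHom a b).trans ?_
        refine (congrArg₂ S.pair ha hb).trans ?_
        apply MackeyFunctor.sum_ext
        · exact (MackeyFunctor.R_inl_pair _ _).trans (MackeyFunctor.R_zero _).symm
        · exact (MackeyFunctor.R_inr_pair _ _).trans (MackeyFunctor.R_zero _).symm
      · simp only [MackeyFunctor.R_inl_pair, MackeyFunctor.R_inr_pair]

theorem TambaraFunctor.extMul_R (T : TambaraFunctor.{u, w} G) {X Y X' Y' : FinGSet G}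
    (f : Map X X') (g : Map Y Y') (a : T.obj X') (b : T.obj Y') :
    T.extMul (T.R f a) (T.R g b) = T.R (prodMap f g) (T.extMul a b) := by
  rw [extMul, extMul, R_mul, ← T.R_comp, ← T.R_comp, ← T.R_comp, ← T.R_comp]
  rfl

theorem TambaraFunctor.T_mul (T : TambaraFunctor.{u, w} G) {X Y : FinGSet G} (f : Map X Y)
    (a : T.obj X) (b : T.obj Y) : T.T f (a * T.R f b) = T.T f a * b :=
  T_mul_R f a b

theorem TambaraFunctor.extMul_T (T : TambaraFunctor.{u, w} G) {X Y X' Y' : FinGSet G}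
    (f : Map X X') (g : Map Y Y') (a : T.obj X) (b : T.obj Y) :
    T.extMul (T.T f a) (T.T g b) = T.T (prodMap f g) (T.extMul a b) := by
  have h1 : T.extMul (T.T f a) (T.T g b) = T.T (prodMap f (idm Y')) (T.extMul a (T.T g b)) := by
    have c : IsCartesian (fst X Y') (prodMap f (idm Y')) f (fst X' Y') :=
      ⟨fun _ => rfl, fun x y h => ⟨(x, y.2), ⟨rfl, Prod.ext h rfl⟩, fun v hv =>
        Prod.ext hv.1 (congrArg (fun t : X'.carrier × Y'.carrier => t.2) hv.2)⟩⟩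
    rw [extMul, extMul, ← T.T_R c, ← T_mul, ← T.R_comp]
    rfl
  have h2 : T.extMul a (T.T g b) = T.T (prodMap (idm X) g) (T.extMul a b) := by
    have c : IsCartesian (snd X Y) (prodMap (idm X) g) g (snd X Y') :=
      ⟨fun _ => rfl, fun x y h => ⟨(y.1, x), ⟨rfl, Prod.ext rfl h⟩, fun v hv =>
        Prod.ext (congrArg (fun t : X.carrier × Y'.carrier => t.1) hv.2) hv.1⟩⟩
    rw [extMul, extMul, ← T.T_R c, mul_comm, ← T_mul, ← T.R_comp, mul_comm]
    rfl
  rw [h1, h2, ← T.T_comp]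
  rfl

theorem TambaraFunctor.Hom.app_extMul {T T' : TambaraFunctor.{u, w} G} (φ : Hom T T')
    {X Y : FinGSet G} (a : T.obj X) (b : T.obj Y) :
    φ.app _ (T.extMul a b) = T'.extMul (φ.app X a) (φ.app Y b) := by
  rw [extMul, φ.app_mul, φ.app_R, φ.app_R, extMul]

/-- The naive `S`-module `Λ T`, with action `ν(a, m) = η(a) m`. -/
noncomputable def AugAlg.ker (T : AugAlg S) : NMod S where
  mackey := T.kerMackey
  ν {X Y} a m := ⟨T.tambara.extMul (T.η.app X a) m.1, by
    rw [T.ε.app_extMul, m.2, TambaraFunctor.extMul,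
      show S.R (snd X Y) (0 : S.obj Y) = 0 from MackeyFunctor.R_zero _, mul_zero]⟩
  ν_R f g a m := Subtype.ext (by
    rw [T.η.app_R]
    exact T.tambara.extMul_R f g _ _)
  ν_T f g a m := Subtype.ext (by
    rw [T.η.app_T]
    exact T.tambara.extMul_T f g _ _)
  ν_assoc {X Y Z} a b m := Subtype.ext (by
    change T.tambara.extMul (T.η.app _ (S.extMul a b)) m.1 = T.tambara.R (assoc X Y Z)
      (T.tambara.extMul (T.η.app X a) (T.tambara.extMul (T.η.app Y b) m.1))
    rw [T.η.app_extMul]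
    simp only [TambaraFunctor.extMul, TambaraFunctor.R_mul, ← T.tambara.R_comp, mul_assoc]
    rfl)
  ν_one {X} m := Subtype.ext (by
    change T.tambara.extMul (T.η.app point 1) m.1 = T.tambara.R (snd point X) m.1
    rw [T.η.app_one, TambaraFunctor.extMul, TambaraFunctor.R_one, one_mul])

/-- The functor `Λ : Mod_S → NMod_S`. -/
noncomputable def SMod.Λ (S : TambaraFunctor.{u, w} G) : SMod S ⥤ NMod S where
  obj T := T.X.ker
  map {T T'} φ :=
    { hom :=
        { app := fun X a => ⟨φ.hom.hom.hom.app X a.1,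
            (congrArg (fun k : TambaraFunctor.Hom T.tambara S => k.app X a.1)
              φ.hom.hom.hom_ε).trans a.2⟩
          app_R := fun f a => Subtype.ext (φ.hom.hom.hom.app_R f a.1)
          app_T := fun f a => Subtype.ext (φ.hom.hom.hom.app_T f a.1) }
      hom_ν := fun {X Y} a m => Subtype.ext ((φ.hom.hom.hom.app_extMul _ _).trans
        (congrArg (fun b => T'.tambara.extMul b (φ.hom.hom.hom.app Y m.1))
          (congrArg (fun k : TambaraFunctor.Hom S T'.tambara => k.app X a)
            φ.hom.hom.η_hom))) }

end Lambda

section Pi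

variable {G : Type u} [Group G] {S : TambaraFunctor.{u, w} G}

/-- `e` identifies the Mackey functors underlying the `S`-modules `Π M` with `S ⊕ M`, in such a way
that `η(a) = (a, 0)`, `ε(a, m) = a`, `σ((a, m), (a, m')) = (a, m + m')`, and the norm maps are
`N_f(a, m) = (N_f(a), T_f(N_π R_π'(a) m))`. This determines `Π` up to unique isomorphism. -/
structure IsPi (P : NMod S ⥤ SMod S) (e : P ⋙ SMod.toMackey S ≅ NMod.addS S) : Prop where
  η_eq : ∀ (M : NMod S) (X : FinGSet G) (a : S.obj X),
    (e.hom.app M).app X ((P.obj M).η.app X a) = (a, 0)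
  ε_eq : ∀ (M : NMod S) (X : FinGSet G) (x : (P.obj M).tambara.obj X),
    (P.obj M).ε.app X x = ((e.hom.app M).app X x).1
  σ_eq : ∀ (M : NMod S) (X : FinGSet G) (x y : (P.obj M).tambara.obj X)
    (h : (P.obj M).ε.app X x = (P.obj M).ε.app X y),
    (e.hom.app M).app X ((P.obj M).σ x y h) =
      (((e.hom.app M).app X x).1, ((e.hom.app M).app X x).2 + ((e.hom.app M).app X y).2)
  norm_eq : ∀ (M : NMod S) (X Y : FinGSet G) (f : Map X Y) (x : (P.obj M).tambara.obj X),
    (e.hom.app M).app Y ((P.obj M).tambara.N f x) = M.norm f ((e.hom.app M).app X x)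

/-- `θ : ΛΠM → M` is given by `(0, m) ↦ m`. -/
def IsTheta (P : NMod S ⥤ SMod S) (e : P ⋙ SMod.toMackey S ≅ NMod.addS S)
    (θ : P ⋙ SMod.Λ S ≅ 𝟭 (NMod S)) : Prop :=
  ∀ (M : NMod S) (X : FinGSet G) (x : ((SMod.Λ S).obj (P.obj M)).mackey.obj X),
    (θ.hom.app M).hom.app X x = ((e.hom.app M).app X x.1).2

/-- `φ : ΠΛT → T` is given by `(a, m) ↦ η(a) + m`. -/
def IsPhi (P : NMod S ⥤ SMod S) (e : P ⋙ SMod.toMackey S ≅ NMod.addS S)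
    (φ : SMod.Λ S ⋙ P ⋙ SMod.toMackey S ⟶ SMod.toMackey S) : Prop :=
  ∀ (T : SMod S) (X : FinGSet G) (x : (P.obj ((SMod.Λ S).obj T)).tambara.obj X),
    (φ.app T).app X x =
      T.η.app X ((e.hom.app ((SMod.Λ S).obj T)).app X x).1 +
        ((e.hom.app ((SMod.Λ S).obj T)).app X x).2.1

end Pi

/-!
The norm formula of `Π` is the case of a square-zero ideal. For a map `f : X → Y`, write
`c_f(a) = N_π R_π'(a)` (`TambaraFunctor.conorm`); informally, the value of `c_f(a)` at `x` is the
product of the values of `a` at the other points of the fibre through `x`, so that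
`N_f(a, m) = (N_f(a), T_f(c_f(a) m))` is the Leibniz rule. That `S ⊕ M` is a Tambara functor
(`NMod.squareZero`) comes down to four identities in `S`, combined with Frobenius reciprocity for
the action on `M`:
* `c_1(a) = 1` (`conorm_id`);
* `c_{g f}(a) = R_f(c_g(N_f a)) c_f(a)` (`conorm_comp`), because the pairs `x ≠ x'` in a fibre of
  `g f` split into those with `f(x) ≠ f(x')` and those with `f(x) = f(x')`;
* `c_g(R_f a) = R_f(c_h(a))` for a cartesian square (`conorm_R`);
* `T_p(c_q(R_p a)) = R_g(c_h(T_g a))` for the distributor of `g` and `h` (`T_conorm_distQ`). Its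
  set `A` of pairs `(y, s)`, with `s` a section over a fibre of `h`, is at the same time the set of
  pairs of a point `x = s(y)` and a section over the rest of the fibre through `g(x)`; so the
  distributive law for a pulled back pair of maps gives both sides.

The same formula gives the multiplication `(a, m) (b, n) = (a b, b m + a n)`, from which `Λ Π M ≅ M`
as naive modules. If `S` has additive inverses, `t ↦ (ε(t), t - η(ε(t)))` inverts `φ`.

In the counterexample `S` is the constant Tambara functor `𝔽₂`. The kernel of the augmentation of
`Π Λ T` has `N_f(0, m) = (N_f(0), T_f(c_f(0) m))`, so it suffices to find a module `T` over `S` and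
`m` in the kernel at the free orbit whose norm is not a transfer plus an element of `η(S)`. In
characteristic `2` the transfer from the free orbit to the point is zero on invariants and the norm
is the square, which is additive. Take the value `𝔽₂[t]/t²` at the free orbit and `𝔽₂[t²]/t⁴` at
the point: then `N(t) = t²` is nonzero. This `T` is obtained as a subquotient of the constant
Tambara functor `𝔽₂[t]` (`TambaraFunctor.PER.quotient`), so that the axioms of a Tambara functor
need only be checked for functions, sums and products. That the subquotient and its addition
`u + v - u(0)` are compatible with norms is one statement about pairs of subrings `A, B` such that
the squares of elements of `A` lie in `B` (`IsLevelwise.prod_fibre`).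
-/

/-! ### The internal action on a naive module -/

namespace NMod

variable {G : Type u} [Group G] {S : TambaraFunctor.{u, w} G} (M : NMod S) {X Y : FinGSet G}

theorem R_act (f : Map X Y) (a : S.obj Y) (m : M.mackey.obj Y) :
    M.mackey.R f (M.act a m) = M.act (S.R f a) (M.mackey.R f m) := by
  rw [act, act, M.ν_R, ← M.mackey.R_comp, ← M.mackey.R_comp]
  rfl

/-- Frobenius reciprocity for a transfer in the module variable. -/
theorem T_act_R (f : Map X Y) (a : S.obj Y) (m : M.mackey.obj X) :
    M.mackey.T f (M.act (S.R f a) m) = M.act a (M.mackey.T f m) := by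
  have c : IsCartesian ((prodMap f (idm X)).comp (diag X)) f (prodMap (idm Y) f) (diag Y) :=
    ⟨fun _ => rfl, fun x y h => ⟨x.2, ⟨Prod.ext ((congrArg Prod.snd h).trans
      (congrArg Prod.fst h).symm) rfl, congrArg Prod.snd h⟩, fun v hv => congrArg Prod.snd hv.1⟩⟩
  have h1 := M.ν_T (idm Y) f a m
  have h2 := M.ν_R f (idm X) a m
  rw [S.T_id] at h1
  rw [M.mackey.R_id] at h2
  rw [act, act, h1, h2, ← M.mackey.T_R c, M.mackey.R_comp]

/-- Frobenius reciprocity for a transfer in the scalar variable. -/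
theorem T_act_R' (f : Map X Y) (a : S.obj X) (m : M.mackey.obj Y) :
    M.mackey.T f (M.act a (M.mackey.R f m)) = M.act (S.T f a) m := by
  have c : IsCartesian ((prodMap (idm X) f).comp (diag X)) f (prodMap f (idm Y)) (diag Y) :=
    ⟨fun _ => rfl, fun x y h => ⟨x.1, ⟨Prod.ext rfl ((congrArg Prod.fst h).trans
      (congrArg Prod.snd h).symm), congrArg Prod.fst h⟩, fun v hv => congrArg Prod.fst hv.1⟩⟩
  have h1 := M.ν_T f (idm Y) a m
  have h2 := M.ν_R (idm X) f a m
  rw [M.mackey.T_id] at h1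
  rw [S.R_id] at h2
  rw [act, act, h1, h2, ← M.mackey.T_R c, M.mackey.R_comp]

theorem mul_eq_R_extMul (a b : S.obj X) : a * b = S.R (diag X) (S.extMul a b) := by
  rw [TambaraFunctor.extMul, TambaraFunctor.R_mul, ← S.R_comp, ← S.R_comp]
  exact congrArg₂ _ (S.R_id a).symm (S.R_id b).symm

theorem act_mul (a b : S.obj X) (m : M.mackey.obj X) :
    M.act (a * b) m = M.act a (M.act b m) := by
  have h1 := M.ν_R (diag X) (idm X) (S.extMul a b) m
  have h2 := M.ν_R (idm X) (diag X) a (M.ν b m)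
  rw [M.mackey.R_id] at h1
  rw [S.R_id] at h2
  rw [act, act, act, mul_eq_R_extMul, h1, h2, M.ν_assoc, ← M.mackey.R_comp, ← M.mackey.R_comp,
    ← M.mackey.R_comp]
  rfl

theorem one_act (m : M.mackey.obj X) : M.act 1 m = m := by
  have h1 := M.ν_R (toPoint X) (idm X) 1 m
  rw [M.mackey.R_id, TambaraFunctor.R_one] at h1
  rw [act, h1, M.ν_one, ← M.mackey.R_comp, ← M.mackey.R_comp]
  exact M.mackey.R_id m

theorem act_zero (a : S.obj X) : M.act a 0 = 0 := by
  have := M.mackey.subsingleton_empty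
  change M.act a (M.mackey.zero X) = M.mackey.zero X
  rw [MackeyFunctor.zero, ← T_act_R]
  congr 1
  exact Subsingleton.elim _ _

theorem act_add (a : S.obj X) (m m' : M.mackey.obj X) :
    M.act a (m + m') = M.act a m + M.act a m' := by
  change M.act a (M.mackey.add m m') = M.mackey.add _ _
  rw [MackeyFunctor.add, ← T_act_R, MackeyFunctor.add]
  congr 1
  apply MackeyFunctor.sum_ext
  · rw [R_act, MackeyFunctor.R_inl_pair, MackeyFunctor.R_inl_pair, MackeyFunctor.R_fold,
      MackeyFunctor.R_inl_pair]
  · rw [R_act, MackeyFunctor.R_inr_pair, MackeyFunctor.R_inr_pair, MackeyFunctor.R_fold,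
      MackeyFunctor.R_inr_pair]

theorem Hom.app_act {M M' : NMod S} (φ : Hom M M') (a : S.obj X) (m : M.mackey.obj X) :
    φ.hom.app X (M.act a m) = M'.act a (φ.hom.app X m) := by
  rw [act, φ.hom.app_R, φ.hom_ν, act]

end NMod

/-! ### Complementary norms -/

namespace FinGSet

variable {G : Type u} [Group G]

/-- The invariant subset of a finite `G`-set that is cut out by an invariant predicate. -/
def sub (X : FinGSet G) (p : X → Prop) (hp : ∀ (c : G) (x : X), p x → p (c • x)) :
    FinGSet G where
  carrier := {x : X.carrier // p x}
  action :=
    { smul := fun c x => ⟨c • x.1, hp c x.1 x.2⟩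
      one_smul := fun x => Subtype.ext (one_smul G x.1)
      mul_smul := fun c d x => Subtype.ext (mul_smul c d x.1) }

variable {X Y Z : FinGSet G} (g : Map X Y) (h : Map Y Z)

/-- The set of pairs `(x, y') ∈ X × Y` with `g(x) ≠ y'` and `h(g(x)) = h(y')`, the pullback of
the off-diagonal set of `h` along `g` in the first variable. -/
def offPull : FinGSet G :=
  sub (X.prod Y) (fun v => g v.1 ≠ v.2 ∧ h (g v.1) = h v.2) fun c v hv => by
    change g (c • v.1) ≠ c • v.2 ∧ h (g (c • v.1)) = h (c • v.2)
    rw [map_smul, map_smul, map_smul, hv.2]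
    exact ⟨fun e => hv.1 (smul_left_cancel c e), rfl⟩

/-- The set of pairs `(x, x') ∈ X²` with `g(x) ≠ g(x')` and `h(g(x)) = h(g(x'))`, the pullback of
the off-diagonal set of `h` along `g` in both variables. -/
def offPull₂ : FinGSet G :=
  sub (X.prod X) (fun v => g v.1 ≠ g v.2 ∧ h (g v.1) = h (g v.2)) fun c v hv => by
    change g (c • v.1) ≠ g (c • v.2) ∧ h (g (c • v.1)) = h (g (c • v.2))
    rw [map_smul, map_smul, map_smul, map_smul, hv.2]
    exact ⟨fun e => hv.1 (smul_left_cancel c e), rfl⟩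

/-- `(x, y') ↦ x`. -/
def offPullFst : Map (offPull g h) X where
  toFun := fun v => v.1.1
  map_smul' := fun _ _ => rfl

/-- `(x, y') ↦ y'`. -/
def offPullSnd : Map (offPull g h) Y where
  toFun := fun v => v.1.2
  map_smul' := fun _ _ => rfl

/-- `(x, y') ↦ (g(x), y')`. -/
def offPullToOffDiag : Map (offPull g h) (offDiag h) where
  toFun := fun v => ⟨(g v.1.1, v.1.2), v.2⟩
  map_smul' := fun c v => Subtype.ext (Prod.ext (map_smul g c v.1.1) rfl)

/-- `(x, x') ↦ x'`. -/
def offPull₂Snd : Map (offPull₂ g h) X where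
  toFun := fun v => v.1.2
  map_smul' := fun _ _ => rfl

/-- `(x, x') ↦ (x, g(x'))`. -/
def offPull₂ToOffPull : Map (offPull₂ g h) (offPull g h) where
  toFun := fun v => ⟨(v.1.1, g v.1.2), v.2⟩
  map_smul' := fun c v => Subtype.ext (Prod.ext rfl (map_smul g c v.1.2))

theorem isCartesian_offPull :
    IsCartesian (offPullToOffDiag g h) (offPullFst g h) (offFst h) g :=
  ⟨fun _ => rfl, fun x y e => ⟨⟨(y, x.1.2), ⟨fun k => x.2.1 (Eq.trans e k),
      (congrArg h (Eq.symm e)).trans x.2.2⟩⟩, ⟨Subtype.ext (Prod.ext e.symm rfl), rfl⟩, fun _ hv =>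
      Subtype.ext (Prod.ext hv.2
      (congrArg (fun t : offDiag h => t.1.2) hv.1))⟩⟩

theorem isCartesian_offPull₂ :
    IsCartesian (offPull₂Snd g h) (offPull₂ToOffPull g h) g (offPullSnd g h) :=
  ⟨fun _ => rfl, fun x y e => ⟨⟨(y.1.1, x), ⟨fun k => y.2.1 (Eq.trans k e),
      y.2.2.trans (congrArg h (Eq.symm e))⟩⟩, ⟨rfl, Subtype.ext (Prod.ext rfl e)⟩,
    fun _ hv => Subtype.ext (Prod.ext (congrArg (fun t : offPull g h => t.1.1) hv.2) hv.1)⟩⟩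

end FinGSet

namespace TambaraFunctor

variable {G : Type u} [Group G] (S : TambaraFunctor.{u, w} G) {W X Y Z : FinGSet G}

/-- The complementary norm `N_π R_π'(a)`: informally, its value at `x` is the product of the
values of `a` at the other points of the fibre of `f` through `x`. -/
def conorm (f : Map X Y) (a : S.obj X) : S.obj X :=
  S.N (offFst f) (S.R (offSnd f) a)

theorem N_eq_one_of_isEmpty [he : IsEmpty X] (f : Map X Y) (a : S.obj X) : S.N f a = 1 := by
  have hi : Function.Bijective (fromEmpty X) := ⟨fun x => x.elim, fun x => he.elim x⟩
  have := S.subsingleton_empty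
  rw [← N_R_of_bijective hi a, ← S.N_comp]
  change _ = S.one Y
  rw [one, show f.comp (fromEmpty X) = fromEmpty Y from MulActionHom.ext fun x => x.elim]
  congr 1
  exact Subsingleton.elim _ _

/-- A norm along a map whose source is a disjoint union is a product of two norms. -/
theorem N_eq_mul_of_bijective {K L : FinGSet G} (f : Map X Y) (i : Map K X) (j : Map L X)
    (hij : Function.Bijective (Sum.elim i j)) (a : S.obj X) :
    S.N f a = S.N (f.comp i) (S.R i a) * S.N (f.comp j) (S.R j a) := by
  let β : Map (K.sum L) X := (fold X).comp (sumMap i j)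
  have hβ : Function.Bijective β := by
    have e : (β : K.carrier ⊕ L.carrier → X.carrier) = Sum.elim i j := by
      funext x
      rcases x with x | x <;> rfl
    exact e ▸ hij
  change _ = S.N (fold Y) (S.pair _ _)
  have h := MackeyFunctor.T_sumMap_pair (M := S.normMackey) (f.comp i) (f.comp j)
    (S.R i a) (S.R j a)
  change S.N _ (S.pair _ _) = S.pair (S.N _ _) (S.N _ _) at h
  have hc : (fold Y).comp (sumMap (f.comp i) (f.comp j)) = f.comp β := by
    ext (x | x) <;> rfl
  rw [← h, ← S.N_comp, hc, S.N_comp, ← MackeyFunctor.R_sumMap_pair, ← MackeyFunctor.R_fold,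
    ← S.R_comp, N_R_of_bijective hβ]

theorem conorm_id (a : S.obj X) : S.conorm (idm X) a = 1 := by
  have : IsEmpty (offDiag (idm X)) := ⟨fun x => x.2.1 x.2.2⟩
  exact S.N_eq_one_of_isEmpty _ _

/-- Base change of a complementary norm to the pairs `(x, y')` with `y'` in the fibre through `g(x)`
and different from `g(x)`. -/
theorem R_conorm_eq (g : Map X Y) (h : Map Y Z) (b : S.obj Y) :
    S.R g (S.conorm h b) = S.N (offPullFst g h) (S.R (offPullSnd g h) b) := by
  rw [conorm, ← S.N_R (isCartesian_offPull g h), ← S.R_comp]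
  rfl

/-- The pairs `x ≠ x'` in a fibre of `g f` split into those with `f(x) ≠ f(x')`, which contribute
the first factor, and those with `f(x) = f(x')`. -/
theorem conorm_comp (g : Map Y Z) (f : Map X Y) (a : S.obj X) :
    S.conorm (g.comp f) a = S.R f (S.conorm g (S.N f a)) * S.conorm f a := by
  rw [R_conorm_eq, ← S.N_R (isCartesian_offPull₂ f g), ← S.N_comp]
  -- The inclusions of the two kinds of pairs into the off-diagonal set of `g f`.
  let i : Map (offPull₂ f g) (offDiag (g.comp f)) :=
    { toFun := fun v => ⟨v.1, fun e => v.2.1 (congrArg f e), v.2.2⟩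
      map_smul' := fun _ _ => rfl }
  let j : Map (offDiag f) (offDiag (g.comp f)) :=
    { toFun := fun v => ⟨v.1, v.2.1, congrArg g v.2.2⟩
      map_smul' := fun _ _ => rfl }
  have hij : Function.Bijective (Sum.elim i j) := by
    constructor
    · rintro (x | x) (y | y) e
      · exact congrArg Sum.inl (Subtype.ext (congrArg (fun t => t.1) e))
      · have e' : x.1 = y.1 := congrArg (fun t => t.1) e
        exact absurd y.2.2 (e' ▸ x.2.1)
      · have e' : x.1 = y.1 := congrArg (fun t => t.1) e
        exact absurd x.2.2 (e' ▸ y.2.1)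
      · exact congrArg Sum.inr (Subtype.ext (congrArg (fun t => t.1) e))
    · intro v
      by_cases hv : f v.1.1 = f v.1.2
      · exact ⟨Sum.inr ⟨v.1, v.2.1, hv⟩, rfl⟩
      · exact ⟨Sum.inl ⟨v.1, hv, v.2.2⟩, rfl⟩
  rw [conorm, S.N_eq_mul_of_bijective _ i j hij, ← S.R_comp, ← S.R_comp]
  rfl

/-- Complementary norms commute with base change. -/
theorem conorm_R {f : Map W X} {g : Map W Y} {h : Map X Z} {k : Map Y Z}
    (c : IsCartesian f g h k) (a : S.obj X) :
    S.conorm g (S.R f a) = S.R f (S.conorm h a) := by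
  let F : Map (offDiag g) (offDiag h) :=
    { toFun := fun v => ⟨(f v.1.1, f v.1.2), fun e => v.2.1 ((c.2 _ _ (c.1 v.1.1)).unique
          ⟨rfl, rfl⟩ ⟨Eq.symm e, v.2.2.symm⟩), by
        change h (f v.1.1) = h (f v.1.2)
        rw [c.1, c.1, v.2.2]⟩
      map_smul' := fun d v =>
        Subtype.ext (Prod.ext (map_smul f d v.1.1) (map_smul f d v.1.2)) }
  have hF : IsCartesian F (offFst g) (offFst h) f := by
    refine ⟨fun _ => rfl, fun x y e => ?_⟩
    have e' : x.1.1 = f y := e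
    obtain ⟨y', hy', -⟩ := c.2 x.1.2 (g y) (by rw [← x.2.2, e', c.1])
    refine ⟨⟨(y, y'), fun e'' => x.2.1 ?_, hy'.2.symm⟩,
      ⟨Subtype.ext (Prod.ext e'.symm hy'.1), rfl⟩, ?_⟩
    · rw [e', ← hy'.1]
      exact congrArg f e''
    · intro v hv
      have h1 : v.1.1 = y := hv.2
      have h2 : f v.1.2 = x.1.2 := congrArg (fun t : offDiag h => t.1.2) hv.1
      refine Subtype.ext (Prod.ext h1 ?_)
      refine (c.2 x.1.2 (g y) (by rw [← x.2.2, e', c.1])).unique ⟨h2, ?_⟩ hy'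
      rw [← v.2.2, h1]
  rw [conorm, conorm, ← S.N_R hF, ← S.R_comp, ← S.R_comp]
  rfl

/-- The distributive law, for a diagram that is isomorphic to the distributor. -/
theorem N_T_of_bijective {A B : FinGSet G} (g : Map X Y) (h : Map Y Z) {p : Map A X}
    {q : Map A B} {r : Map B Z} {α : Map A (distA g h)} {β : Map B (distB g h)}
    (hα : Function.Bijective α) (hβ : Function.Bijective β) (hp : (distP g h).comp α = p)
    (hq : (distQ g h).comp α = β.comp q) (hr : (distR g h).comp β = r) (a : S.obj X) :
    S.N h (S.T g a) = S.T r (S.N q (S.R p a)) := by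
  rw [S.N_T, ← hr, S.T_comp, T_eq_N_of_bijective hβ, ← S.N_comp, ← hq, S.N_comp, ← hp, S.R_comp,
    N_R_of_bijective hα]

section Distributor

variable (g : Map X Y) (h : Map Y Z)

/-- For a point `a = (y, (z, s))` of the distributor, the point `s(y)` of `X` together with the
section `(s(y), y') ↦ (s(y), s(y'))` over the points `y' ≠ y` of `h⁻¹(z)`. -/
def offDistB : Map (distA g h) (distB (offPull₂ToOffPull g h) (offPullFst g h)) where
  toFun := fun a =>
    { base := distP g h a
      sec := fun v =>
        have e : g v.1.1.1 = a.1.1 :=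
          (congrArg g (show v.1.1.1 = distP g h a from v.2)).trans (a.1.2.sec_spec _)
        have e' : h v.1.1.2 = a.1.2.base := by rw [← v.1.2.2, e, a.2]
        have k : g (a.1.2.sec ⟨v.1.1.2, e'⟩) = v.1.1.2 := a.1.2.sec_spec _
        ⟨(v.1.1.1, a.1.2.sec ⟨v.1.1.2, e'⟩), fun k' => v.1.2.1 (Eq.trans k' k),
          v.1.2.2.trans (congrArg h k.symm)⟩
      sec_spec := fun v => Subtype.ext (Prod.ext rfl (a.1.2.sec_spec _)) }
  map_smul' := fun c a => DistB.ext' (map_smul (distP g h) c a) fun v e e' =>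
    Subtype.ext (Prod.ext (smul_inv_smul c v.1.1).symm rfl)

/-- Two points of the distributor with the same value `x` of `p` lie over the same `y = g(x)`; so a
point is determined by `x` and the restriction of the section to the complement of `y`, and every
such pair occurs. -/
theorem offDistB_bijective : Function.Bijective (offDistB g h) := by
  classical
  constructor
  · intro a a' e
    have h1 : distP g h a = distP g h a' := congrArg DistB.base e
    have hy : a.1.1 = a'.1.1 :=
      (a.1.2.sec_spec ⟨a.1.1, a.2⟩).symm.trans
        ((congrArg g h1).trans (a'.1.2.sec_spec ⟨a'.1.1, a'.2⟩))
    refine Subtype.ext (Prod.ext hy (DistB.ext' ?_ fun y e1 e2 => ?_))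
    · rw [← a.2, ← a'.2, hy]
    · by_cases hya : y = a.1.1
      · subst hya
        exact h1.trans (a'.1.2.sec_congr _ _ hy.symm)
      · have hg : g (distP g h a) = a.1.1 := a.1.2.sec_spec _
        let v : offPull g h := ⟨(distP g h a, y), by
          change g (distP g h a) ≠ y ∧ h (g (distP g h a)) = h y
          rw [hg, a.2, e1]
          exact ⟨Ne.symm hya, rfl⟩⟩
        have key : ∀ b b' : DistB (offPull₂ToOffPull g h) (offPullFst g h), b = b' →
            ∀ (k : offPullFst g h v = b.base) (k' : offPullFst g h v = b'.base),
            (b.sec ⟨v, k⟩).1.2 = (b'.sec ⟨v, k'⟩).1.2 := by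
          rintro b _ rfl k k'
          rfl
        exact key _ _ e rfl h1
  · intro b
    have hg : ∀ y : Y, h y = h (g b.base) → g b.base ≠ y → g b.base ≠ y ∧ h (g b.base) = h y :=
      fun y e e' => ⟨e', e.symm⟩
    -- The section that sends `g(x)` to `x`, where `x` is the base of `b`, and is given by `b` at
    -- the other points of the fibre.
    let s : DistB g h :=
      { base := h (g b.base)
        sec := fun y => if e : g b.base = y.1 then b.base else
          (b.sec ⟨⟨(b.base, y.1), hg y.1 y.2 e⟩, rfl⟩).1.2
        sec_spec := fun y => by
          split_ifs with e
          · exact e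
          · exact congrArg (fun t : offPull g h => t.1.2)
              (b.sec_spec ⟨⟨(b.base, y.1), hg y.1 y.2 e⟩, rfl⟩) }
    have hs : distP g h ⟨(g b.base, s), rfl⟩ = b.base := dif_pos rfl
    refine ⟨⟨(g b.base, s), rfl⟩, DistB.ext' hs fun v e e' => Subtype.ext (Prod.ext ?_ ?_)⟩
    · exact congrArg (fun t : offPull g h => t.1.1) (b.sec_spec ⟨v, e'⟩).symm
    · have e1 : v.1.1 = b.base := e'
      have e2 : g b.base ≠ v.1.2 := e1 ▸ v.2.1
      refine (dif_neg e2).trans ?_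
      exact congrArg (fun t : offPull₂ g h => t.1.2)
        (b.sec_congr _ _ (Subtype.ext (Prod.ext e1.symm rfl)))

/-- The pair `(p(a), y')` attached to points `a ≠ a' = (y', (z, s))` of the distributor in the same
fibre. -/
def offDistA : Map (offDiag (distQ g h))
    (distA (offPull₂ToOffPull g h) (offPullFst g h)) where
  toFun := fun v => ⟨(⟨(distP g h v.1.1, v.1.2.1.1), by
      have e : v.1.1.1.2 = v.1.2.1.2 := v.2.2
      have hg : g (distP g h v.1.1) = v.1.1.1.1 := v.1.1.1.2.sec_spec _
      change g (distP g h v.1.1) ≠ _ ∧ h (g (distP g h v.1.1)) = _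
      rw [hg, v.1.1.2, v.1.2.2, e]
      exact ⟨fun e' => v.2.1 (Subtype.ext (Prod.ext e' e)), rfl⟩⟩,
    offDistB g h v.1.1), rfl⟩
  map_smul' := fun c v => Subtype.ext (Prod.ext (Subtype.ext (Prod.ext
    (map_smul (distP g h) c v.1.1) rfl)) (map_smul (offDistB g h) c v.1.1))

theorem offDistA_bijective : Function.Bijective (offDistA g h) := by
  constructor
  · intro v v' e
    have h1 : v.1.1 = v'.1.1 :=
      (offDistB_bijective g h).1 (congrArg (fun t => t.1.2) e)
    have h2 : v.1.2.1.1 = v'.1.2.1.1 := congrArg (fun t => t.1.1.1.2) e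
    have e1 : v.1.1.1.2 = v.1.2.1.2 := v.2.2
    have e2 : v'.1.1.1.2 = v'.1.2.1.2 := v'.2.2
    exact Subtype.ext (Prod.ext h1 (Subtype.ext (Prod.ext h2 (by rw [← e1, ← e2, h1]))))
  · rintro ⟨⟨l, b⟩, e⟩
    obtain ⟨a, rfl⟩ := (offDistB_bijective g h).2 b
    have e1 : l.1.1 = distP g h a := e
    have hg : g (distP g h a) = a.1.1 := a.1.2.sec_spec _
    refine ⟨⟨(a, ⟨(l.1.2, a.1.2), ?_⟩), ?_, rfl⟩, ?_⟩
    · change h l.1.2 = a.1.2.base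
      rw [← l.2.2, e1, hg, a.2]
    · intro e2
      refine l.2.1 ?_
      rw [e1, hg]
      exact congrArg (fun t : distA g h => t.1.1) e2
    · exact Subtype.ext (Prod.ext (Subtype.ext (Prod.ext e1.symm rfl)) rfl)

/-- The map `((y, s), (y', s)) ↦ (s(y), s(y'))` on pairs of points of the distributor in the same
fibre. -/
def offDistP : Map (offDiag (distQ g h)) (offPull₂ g h) :=
  (distP (offPull₂ToOffPull g h) (offPullFst g h)).comp (offDistA g h)

theorem offPull₂Snd_comp_offDistP :
    (offPull₂Snd g h).comp (offDistP g h) = (distP g h).comp (offSnd (distQ g h)) := by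
  ext v
  have e : v.1.1.1.2 = v.1.2.1.2 := v.2.2
  have key : ∀ (b b' : DistB g h), b = b' → ∀ (y : Y) (k : h y = b.base) (k' : h y = b'.base),
      b.sec ⟨y, k⟩ = b'.sec ⟨y, k'⟩ := by
    rintro b _ rfl y k k'
    rfl
  exact key _ _ e v.1.2.1.1 _ _

/-- The complementary norm in the distributor is the complementary norm of a transfer: both sum
over the choices of a preimage under `g` of every other point of the fibre of `h`. -/
theorem T_conorm_distQ (a : S.obj X) :
    S.T (distP g h) (S.conorm (distQ g h) (S.R (distP g h) a)) =
      S.R g (S.conorm h (S.T g a)) := by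
  have hr : (distR (offPull₂ToOffPull g h) (offPullFst g h)).comp (offDistB g h) =
      distP g h := rfl
  rw [R_conorm_eq, ← S.T_R (isCartesian_offPull₂ g h),
    S.N_T_of_bijective _ _ (offDistA_bijective g h) (offDistB_bijective g h)
      (p := offDistP g h) rfl (q := offFst (distQ g h)) rfl hr, ← S.R_comp, conorm, ← S.R_comp,
    offPull₂Snd_comp_offDistP]

end Distributor

end TambaraFunctor

/-! ### Commutative monoids in augmented algebras, on elements -/

section CommMonoidObjects

variable {G : Type u} [Group G] {S : TambaraFunctor.{u, w} G}

theorem TambaraFunctor.Hom.congr_app {T T' : TambaraFunctor.{u, w} G} {f g : T ⟶ T'} (h : f = g)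
    {X : FinGSet G} (a : T.obj X) : f.app X a = g.app X a := by
  rw [h]

namespace AugAlg

theorem hom_ext_app {T T' : AugAlg S} {f g : T ⟶ T'}
    (h : ∀ (X : FinGSet G) (a : T.tambara.obj X), f.hom.app X a = g.hom.app X a) : f = g :=
  Hom.ext (TambaraFunctor.Hom.ext (funext fun X => funext fun a => h X a))

/-- The unit of an augmented algebra, as a map from the terminal one. -/
def unitHom (T : AugAlg S) : unit S ⟶ T := ⟨T.η, Category.id_comp _, T.η_ε⟩

/-- The unit is initial among augmented algebras. -/
theorem unit_hom_ext {T : AugAlg S} (f g : unit S ⟶ T) : f = g :=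
  Hom.ext ((Category.id_comp f.hom).symm.trans
    (f.η_hom.trans (g.η_hom.symm.trans (Category.id_comp g.hom))))

/-- A binary operation `T ×_S T → T` with unit `η` that is associative and commutative on elements
makes `T` a monoid object. -/
@[reducible]
def monObjOfAdd (T : AugAlg S) (add : prod T T ⟶ T)
    (add_comm : ∀ (X : FinGSet G) (a b : T.tambara.obj X) (h : T.ε.app X a = T.ε.app X b),
      add.hom.app X ⟨(a, b), h⟩ = add.hom.app X ⟨(b, a), h.symm⟩)
    (zero_add : ∀ (X : FinGSet G) (b : T.tambara.obj X),
      add.hom.app X ⟨(T.η.app X (T.ε.app X b), b), T.ε_η_app _⟩ = b)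
    (add_assoc : ∀ (X : FinGSet G) (a b c : T.tambara.obj X) (hab : T.ε.app X a = T.ε.app X b)
      (hbc : T.ε.app X b = T.ε.app X c) (h h'),
      add.hom.app X ⟨(add.hom.app X ⟨(a, b), hab⟩, c), h⟩ =
        add.hom.app X ⟨(a, add.hom.app X ⟨(b, c), hbc⟩), h'⟩) :
    MonObj T where
  one := T.unitHom
  mul := add
  one_mul := hom_ext_app fun X a => by
    obtain ⟨⟨s, b⟩, h⟩ := a
    obtain rfl : s = T.ε.app X b := h
    exact zero_add X b
  mul_one := hom_ext_app fun X a => by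
    obtain ⟨⟨b, s⟩, h⟩ := a
    obtain rfl : T.ε.app X b = s := h
    exact (add_comm X _ _ _).trans (zero_add X b)
  mul_assoc := hom_ext_app fun X a => by
    obtain ⟨⟨⟨⟨a, b⟩, hab⟩, c⟩, h⟩ := a
    exact add_assoc X a b c hab (hab.symm.trans h) _ _

theorem isCommMonObj_of_add (T : AugAlg S) [MonObj T]
    (add_comm : ∀ (X : FinGSet G) (a b : T.tambara.obj X) (h : T.ε.app X a = T.ε.app X b),
      (Hom.hom (T := prod T T) (T' := T) (MonObj.mul (X := T))).app X ⟨(a, b), h⟩ =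
      (Hom.hom (T := prod T T) (T' := T) (MonObj.mul (X := T))).app X ⟨(b, a), h.symm⟩) :
    IsCommMonObj T where
  mul_comm := hom_ext_app fun X a => by
    obtain ⟨⟨a, b⟩, h⟩ := a
    exact add_comm X _ _ _

end AugAlg

namespace SMod

/-- The `S`-module given by an augmented algebra `T` and an addition `T ×_S T → T`. -/
def ofAdd (T : AugAlg S) (add : AugAlg.prod T T ⟶ T)
    (add_comm : ∀ (X : FinGSet G) (a b : T.tambara.obj X) (h : T.ε.app X a = T.ε.app X b),
      add.hom.app X ⟨(a, b), h⟩ = add.hom.app X ⟨(b, a), h.symm⟩)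
    (zero_add : ∀ (X : FinGSet G) (b : T.tambara.obj X),
      add.hom.app X ⟨(T.η.app X (T.ε.app X b), b), T.ε_η_app _⟩ = b)
    (add_assoc : ∀ (X : FinGSet G) (a b c : T.tambara.obj X) (hab : T.ε.app X a = T.ε.app X b)
      (hbc : T.ε.app X b = T.ε.app X c) (h h'),
      add.hom.app X ⟨(add.hom.app X ⟨(a, b), hab⟩, c), h⟩ =
        add.hom.app X ⟨(a, add.hom.app X ⟨(b, c), hbc⟩), h'⟩) :
    SMod S :=
  letI := T.monObjOfAdd add add_comm zero_add add_assoc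
  { X := T
    mon := T.monObjOfAdd add add_comm zero_add add_assoc
    comm := T.isCommMonObj_of_add add_comm }

/-- A morphism of augmented algebras that is compatible with the additions on elements is a
morphism of modules. -/
def homOfAdd {T T' : SMod S} (f : T.X ⟶ T'.X)
    (h : ∀ (X : FinGSet G) (a b : T.tambara.obj X) (hab : T.ε.app X a = T.ε.app X b) (h'),
      f.hom.app X (T.σ a b hab) = T'.σ (f.hom.app X a) (f.hom.app X b) h') : T ⟶ T' :=
  CommMon.homMk (Mon.Hom.mk' (M := T.toMon) (N := T'.toMon) f
    (AugAlg.unit_hom_ext _ _)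
    (AugAlg.hom_ext_app fun X a => by
      obtain ⟨⟨a, b⟩, hab⟩ := a
      exact h X a b hab _))

end SMod

end CommMonoidObjects

/-! ### The square-zero extension of a Tambara functor by a naive module -/

section SquareZero

variable {G : Type u} [Group G] {S : TambaraFunctor.{u, w} G}

namespace NMod

/-- The Tambara functor `S ⊕ M` with the norms `N_f(a, m) = (N_f(a), T_f(N_π R_π'(a) m))`. -/
def squareZero (M : NMod S) : TambaraFunctor.{u, w} G where
  toMackeyFunctor := S.toMackeyFunctor.directSum M.mackey
  N f a := M.norm f a
  N_id {X} a := by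
    obtain ⟨a, m⟩ := a
    change (S.N (idm X) a, M.mackey.T (idm X) (M.act (S.conorm (idm X) a) m)) = (a, m)
    rw [S.conorm_id, one_act, S.N_id, M.mackey.T_id]
  N_comp g f a := by
    obtain ⟨a, m⟩ := a
    change (S.N (g.comp f) a, M.mackey.T (g.comp f) (M.act (S.conorm (g.comp f) a) m)) =
      (S.N g (S.N f a), M.mackey.T g (M.act (S.conorm g (S.N f a))
        (M.mackey.T f (M.act (S.conorm f a) m))))
    rw [S.conorm_comp, act_mul, M.mackey.T_comp, T_act_R, S.N_comp]
  N_R {W X Y Z f g h k} c a := by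
    obtain ⟨a, m⟩ := a
    change (S.N g (S.R f a), M.mackey.T g (M.act (S.conorm g (S.R f a)) (M.mackey.R f m))) =
      (S.R k (S.N h a), M.mackey.R k (M.mackey.T h (M.act (S.conorm h a) m)))
    rw [S.conorm_R c, ← R_act, M.mackey.T_R c, S.N_R c]
  N_T {X Y Z} g h a := by
    obtain ⟨a, m⟩ := a
    change (S.N h (S.T g a), M.mackey.T h (M.act (S.conorm h (S.T g a)) (M.mackey.T g m))) =
      (S.T (distR g h) (S.N (distQ g h) (S.R (distP g h) a)),
        M.mackey.T (distR g h) (M.mackey.T (distQ g h)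
          (M.act (S.conorm (distQ g h) (S.R (distP g h) a)) (M.mackey.R (distP g h) m))))
    -- A point `(y, s)` of the distributor goes to `h(y) = h(g(s(y)))` along both composites.
    have e : (distR g h).comp (distQ g h) = (h.comp g).comp (distP g h) :=
      MulActionHom.ext fun v => v.2.symm.trans (congrArg h (v.1.2.sec_spec ⟨v.1.1, v.2⟩).symm)
    rw [← S.N_T, ← M.mackey.T_comp, e, M.mackey.T_comp, T_act_R', S.T_conorm_distQ,
      M.mackey.T_comp, T_act_R]

variable (M : NMod S) {X Y : FinGSet G}

theorem act_pair (a : S.obj X) (b : S.obj Y) (m : M.mackey.obj X) (n : M.mackey.obj Y) :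
    M.act (S.pair a b) (M.mackey.pair m n) = M.mackey.pair (M.act a m) (M.act b n) := by
  apply MackeyFunctor.sum_ext
  · rw [R_act, MackeyFunctor.R_inl_pair, MackeyFunctor.R_inl_pair, MackeyFunctor.R_inl_pair]
  · rw [R_act, MackeyFunctor.R_inr_pair, MackeyFunctor.R_inr_pair, MackeyFunctor.R_inr_pair]

/-- In a fibre of the codiagonal the other point is the copy of `x` in the other summand. -/
theorem conorm_fold (c : S.obj (X.sum X)) :
    S.conorm (fold X) c = S.R (MackeyFunctor.swap X) c := by
  have hne : ∀ v : offDiag (fold X), offSnd (fold X) v = MackeyFunctor.swap X (offFst _ v) := by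
    rintro ⟨⟨x | x, y | y⟩, h1, h2⟩
    · exact absurd (congrArg Sum.inl h2) h1
    · exact congrArg Sum.inr (Eq.symm h2)
    · exact congrArg Sum.inl (Eq.symm h2)
    · exact absurd (congrArg Sum.inr h2) h1
  have hb : Function.Bijective (offFst (fold X)) := by
    constructor
    · intro v v' h
      refine Subtype.ext (Prod.ext h ?_)
      exact (hne v).trans ((congrArg (MackeyFunctor.swap X) h).trans (hne v').symm)
    · rintro (x | x)
      · exact ⟨⟨(Sum.inl x, Sum.inr x), ⟨Sum.inl_ne_inr, rfl⟩⟩, rfl⟩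
      · exact ⟨⟨(Sum.inr x, Sum.inl x), ⟨Sum.inr_ne_inl, rfl⟩⟩, rfl⟩
  have hs : offSnd (fold X) = (MackeyFunctor.swap X).comp (offFst (fold X)) :=
    MulActionHom.ext hne
  rw [TambaraFunctor.conorm, hs, S.R_comp, TambaraFunctor.N_R_of_bijective hb]

theorem R_swap_pair (a b : S.obj X) :
    S.R (MackeyFunctor.swap X) (S.pair a b) = S.pair b a := by
  apply MackeyFunctor.sum_ext
  · rw [MackeyFunctor.R_inl_pair, ← S.R_comp]
    exact MackeyFunctor.R_inr_pair a b
  · rw [MackeyFunctor.R_inr_pair, ← S.R_comp]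
    exact MackeyFunctor.R_inl_pair a b

theorem squareZero_pair (x : M.squareZero.obj X) (y : M.squareZero.obj Y) :
    M.squareZero.pair x y = (S.pair x.1 y.1, M.mackey.pair x.2 y.2) := by
  apply MackeyFunctor.sum_ext
  · rw [MackeyFunctor.R_inl_pair]
    exact (Prod.ext (MackeyFunctor.R_inl_pair _ _) (MackeyFunctor.R_inl_pair _ _)).symm
  · rw [MackeyFunctor.R_inr_pair]
    exact (Prod.ext (MackeyFunctor.R_inr_pair _ _) (MackeyFunctor.R_inr_pair _ _)).symm

/-- The multiplication of `S ⊕ M` is that of a square-zero extension. -/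
theorem squareZero_mul (x y : M.squareZero.obj X) :
    x * y = (x.1 * y.1, M.act y.1 x.2 + M.act x.1 y.2) := by
  change M.squareZero.N (fold X) (M.squareZero.pair x y) = _
  rw [squareZero_pair]
  change (S.N (fold X) (S.pair x.1 y.1), M.mackey.T (fold X)
    (M.act (S.conorm (fold X) (S.pair x.1 y.1)) (M.mackey.pair x.2 y.2))) = _
  rw [conorm_fold, R_swap_pair, act_pair]
  rfl

/-- The augmented algebra `S ⊕ M`, with `η(a) = (a, 0)` and `ε(a, m) = a`. -/
noncomputable def squareZeroAlg : AugAlg S where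
  tambara := M.squareZero
  η :=
    { app := fun X a => (a, 0)
      app_R := fun f a => Prod.ext rfl (MackeyFunctor.R_zero f).symm
      app_T := fun f a => Prod.ext rfl (MackeyFunctor.T_zero f).symm
      app_N := fun f a => Prod.ext rfl (by
        change _ = M.mackey.T f (M.act _ 0)
        rw [act_zero]
        exact (MackeyFunctor.T_zero f).symm) }
  ε :=
    { app := fun X x => x.1
      app_R := fun _ _ => rfl
      app_T := fun _ _ => rfl
      app_N := fun _ _ => rfl }
  η_ε := rfl

/-- The addition `σ((a, m), (a, m')) = (a, m + m')`. -/
noncomputable def squareZeroAdd :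
    AugAlg.prod M.squareZeroAlg M.squareZeroAlg ⟶ M.squareZeroAlg where
  hom :=
    { app := fun X x => (x.1.1.1, x.1.1.2 + x.1.2.2)
      app_R := fun f x => Prod.ext rfl (MackeyFunctor.R_add f _ _).symm
      app_T := fun f x => Prod.ext rfl (MackeyFunctor.T_add f _ _).symm
      app_N := by
        rintro X Y f ⟨⟨⟨a, m⟩, ⟨b, n⟩⟩, h⟩
        obtain rfl : a = b := h
        refine Prod.ext rfl ?_
        change M.mackey.T f (M.act (S.conorm f a) m) + M.mackey.T f (M.act (S.conorm f a) n) =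
          M.mackey.T f (M.act (S.conorm f a) (m + n))
        rw [act_add]
        exact (MackeyFunctor.T_add f _ _).symm }
  η_hom := TambaraFunctor.Hom.ext (funext fun X => funext fun a =>
    Prod.ext rfl (add_zero (0 : M.mackey.obj X)))
  hom_ε := rfl

/-- The `S`-module `Π M = S ⊕ M`. -/
noncomputable def squareZeroMod : SMod S :=
  SMod.ofAdd M.squareZeroAlg M.squareZeroAdd
    (fun _ a b h => Prod.ext h (add_comm a.2 b.2))
    (fun _ b => Prod.ext rfl (zero_add b.2))
    (fun _ a b c _ _ _ _ => Prod.ext rfl (add_assoc a.2 b.2 c.2))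

/-- The functor `Π`. -/
noncomputable def Pi (S : TambaraFunctor.{u, w} G) : NMod S ⥤ SMod S where
  obj M := M.squareZeroMod
  map {M M'} φ := SMod.homOfAdd (T := M.squareZeroMod) (T' := M'.squareZeroMod)
    { hom :=
        { app := fun X x => (x.1, φ.hom.app X x.2)
          app_R := fun f x => Prod.ext rfl (φ.hom.app_R f x.2)
          app_T := fun f x => Prod.ext rfl (φ.hom.app_T f x.2)
          app_N := fun f _ => Prod.ext rfl ((φ.hom.app_T f _).trans
            (congrArg (M'.mackey.T f) (Hom.app_act φ _ _))) }
      η_hom := TambaraFunctor.Hom.ext (funext fun X => funext fun _ =>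
        Prod.ext rfl (MackeyFunctor.app_zero φ.hom X))
      hom_ε := rfl }
    (fun _ a b _ _ => Prod.ext rfl (MackeyFunctor.app_add φ.hom a.2 b.2))
  map_id _ := rfl
  map_comp _ _ := rfl

/-- The Mackey functor underlying `Π M` is `S ⊕ M`. -/
noncomputable def PiIso (S : TambaraFunctor.{u, w} G) : Pi S ⋙ SMod.toMackey S ≅ addS S :=
  NatIso.ofComponents (fun M => Iso.refl (S.toMackeyFunctor.directSum M.mackey)) (fun _ => rfl)

theorem isPi_Pi (S : TambaraFunctor.{u, w} G) : IsPi (Pi S) (PiIso S) where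
  η_eq _ _ _ := rfl
  ε_eq _ _ _ := rfl
  σ_eq _ _ _ _ _ := rfl
  norm_eq _ _ _ _ _ := rfl

/-! ### The comparison of naive modules and modules -/

theorem hom_ext_app {M M' : NMod S} {f g : M ⟶ M'}
    (h : ∀ (X : FinGSet G) (m : M.mackey.obj X), f.hom.app X m = g.hom.app X m) : f = g :=
  Hom.ext (MackeyFunctor.Hom.ext (funext fun X => funext fun m => h X m))

theorem ν_eq_act (a : S.obj X) (m : M.mackey.obj Y) :
    M.ν a m = M.act (S.R (fst X Y) a) (M.mackey.R (snd X Y) m) := by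
  rw [act, M.ν_R, ← M.mackey.R_comp]
  exact (M.mackey.R_id _).symm

/-- `Λ Π M ≅ M`, by `(0, m) ↦ m`. -/
noncomputable def kerPiIso : M.squareZeroAlg.ker ≅ M where
  hom :=
    { hom :=
        { app := fun X x => x.1.2
          app_R := fun _ _ => rfl
          app_T := fun _ _ => rfl }
      hom_ν := fun {X Y} a m => by
        obtain ⟨⟨b, m⟩, h⟩ := m
        change (M.squareZero.R (fst X Y) (a, 0) * M.squareZero.R (snd X Y) (b, m)).2 = M.ν a m
        rw [squareZero_mul, ν_eq_act]
        change M.act _ (M.mackey.R _ 0) + M.act _ (M.mackey.R _ m) = _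
        rw [show M.mackey.R (fst X Y) 0 = 0 from MackeyFunctor.R_zero _, act_zero, zero_add]
        rfl }
  inv :=
    { hom :=
        { app := fun X m => ⟨(0, m), rfl⟩
          app_R := fun f m => Subtype.ext (Prod.ext (MackeyFunctor.R_zero f).symm rfl)
          app_T := fun f m => Subtype.ext (Prod.ext (MackeyFunctor.T_zero f).symm rfl) }
      hom_ν := fun {X Y} a m => Subtype.ext (by
        change (0, M.ν a m) =
          M.squareZero.R (fst X Y) (a, 0) * M.squareZero.R (snd X Y) (0, m)
        rw [squareZero_mul, ν_eq_act]
        refine Prod.ext ?_ ?_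
        · change 0 = _ * S.R (snd X Y) 0
          rw [show S.R (snd X Y) 0 = 0 from MackeyFunctor.R_zero _, mul_zero]
        · change _ = M.act _ (M.mackey.R _ 0) + M.act _ (M.mackey.R _ m)
          rw [show M.mackey.R (fst X Y) 0 = 0 from MackeyFunctor.R_zero _, act_zero, zero_add]
          rfl) }
  hom_inv_id := hom_ext_app fun X x => Subtype.ext (Prod.ext (Eq.symm x.2) rfl)
  inv_hom_id := rfl

/-- The natural isomorphism `Λ Π ≅ 1`. -/
noncomputable def theta (S : TambaraFunctor.{u, w} G) : Pi S ⋙ SMod.Λ S ≅ 𝟭 (NMod S) :=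
  NatIso.ofComponents (fun M => M.kerPiIso) (fun _ => rfl)

theorem isTheta_theta (S : TambaraFunctor.{u, w} G) : IsTheta (Pi S) (PiIso S) (theta S) :=
  fun _ _ _ => rfl

end NMod

theorem MackeyFunctor.isIso_of_bijective {M N : MackeyFunctor.{u, w} G} (f : M ⟶ N)
    (h : ∀ X, Function.Bijective (f.app X)) : IsIso f := by
  let e : ∀ X, M.obj X ≃ N.obj X := fun X => Equiv.ofBijective _ (h X)
  have he : ∀ X (b : N.obj X), f.app X ((e X).symm b) = b := fun X => (e X).apply_symm_apply
  refine ⟨⟨fun X => (e X).symm, fun {X Y} k b => (h X).1 ?_, fun {X Y} k b => (h Y).1 ?_⟩, ?_, ?_⟩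
  · rw [he, f.app_R, he]
  · rw [he, f.app_T, he]
  · exact MackeyFunctor.Hom.ext (funext fun X => funext fun x => (e X).symm_apply_apply x)
  · exact MackeyFunctor.Hom.ext (funext fun X => funext fun x => he X x)

namespace SMod

/-- The morphism of Mackey functors `S ⊕ Λ T → T`, `(a, m) ↦ η(a) + m`. -/
noncomputable def phiApp (T : SMod S) :
    S.toMackeyFunctor.directSum T.X.kerMackey ⟶ T.tambara.toMackeyFunctor where
  app X x := T.η.app X x.1 + x.2.1
  app_R f x := by
    refine Eq.trans ?_ (MackeyFunctor.R_add f _ _).symm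
    exact congrArg (· + T.tambara.R f x.2.1) (T.η.app_R f x.1)
  app_T f x := by
    refine Eq.trans ?_ (MackeyFunctor.T_add f _ _).symm
    exact congrArg (· + T.tambara.T f x.2.1) (T.η.app_T f x.1)

/-- The natural morphism of Mackey functors `Π Λ T → T`, `(a, m) ↦ η(a) + m`. -/
noncomputable def phi (S : TambaraFunctor.{u, w} G) :
    Λ S ⋙ NMod.Pi S ⋙ toMackey S ⟶ toMackey S where
  app T := T.phiApp
  naturality T T' φ := MackeyFunctor.Hom.ext (funext fun X => funext fun x => by
    let ψ : TambaraFunctor.Hom T.tambara T'.tambara := φ.hom.hom.hom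
    change T'.η.app X x.1 + ψ.app X x.2.1 = ψ.app X (T.η.app X x.1 + x.2.1)
    rw [ψ.app_add]
    congr 1
    exact (TambaraFunctor.Hom.congr_app φ.hom.hom.η_hom x.1).symm)

theorem isPhi_phi (S : TambaraFunctor.{u, w} G) : IsPhi (NMod.Pi S) (NMod.PiIso S) (phi S) :=
  fun _ _ _ => rfl

/-- Over an additively complete `S`, an element `t` is determined by `ε(t)` and the element
`t - η(ε(t))` of the kernel of `ε`. -/
theorem bijective_phiApp (hS : S.AdditivelyComplete) (T : SMod S) (X : FinGSet G) :
    Function.Bijective (T.phiApp.app X) := by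
  have hε : ∀ x, T.ε.app X (T.phiApp.app X x) = x.1 := fun x => by
    change T.ε.app X (T.η.app X x.1 + x.2.1) = x.1
    rw [T.ε.app_add, T.X.ε_η_app, x.2.2, add_zero]
  have hη : ∀ a b : S.obj X, a + b = 0 → T.η.app X a + T.η.app X b = 0 := fun a b h => by
    rw [← T.η.app_add, h, T.η.app_zero]
  constructor
  · rintro ⟨a, m, hm⟩ ⟨a', m', hm'⟩ h
    obtain rfl : a = a' := (hε (a, ⟨m, hm⟩)).symm.trans ((congrArg _ h).trans (hε _))
    obtain ⟨b, hb⟩ := hS X a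
    have h' : T.η.app X a + m = T.η.app X a + m' := h
    have : m = m' := by
      rw [← zero_add m, ← zero_add m', ← hη a b hb, add_comm (T.η.app X a), add_assoc, h',
        add_assoc]
    subst this
    rfl
  · intro t
    obtain ⟨b, hb⟩ := hS X (T.ε.app X t)
    refine ⟨(T.ε.app X t, ⟨T.η.app X b + t, ?_⟩), ?_⟩
    · rw [T.ε.app_add, T.X.ε_η_app, add_comm, hb]
    · change T.η.app X (T.ε.app X t) + (T.η.app X b + t) = t
      rw [← add_assoc, hη _ _ hb, zero_add]

theorem isIso_phi (hS : S.AdditivelyComplete) : IsIso (phi S) := by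
  have : ∀ T, IsIso ((phi S).app T) := fun T =>
    MackeyFunctor.isIso_of_bijective T.phiApp (T.bijective_phiApp hS)
  exact NatIso.isIso_of_isIso_app _

end SMod

end SquareZero

/-! ### Constant Tambara functors -/

namespace FinGSet

variable {G : Type u} [Group G] {W X Y Z : FinGSet G}

/-- The fibre of a map, as a finset. -/
noncomputable def fibre (f : Map X Y) (y : Y) : Finset X.carrier :=
  (Set.toFinite {x : X.carrier | f x = y}).toFinset

@[simp]
theorem mem_fibre {f : Map X Y} {y : Y} {x : X} : x ∈ fibre f y ↔ f x = y := by
  simp [fibre]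

theorem prod_fibre_smul {M : Type*} [CommMonoid M] (f : Map X Y) {a : X → M}
    (ha : ∀ (c : G) x, a (c • x) = a x) (c : G) (y : Y) :
    ∏ x ∈ fibre f (c • y), a x = ∏ x ∈ fibre f y, a x := by
  refine Finset.prod_nbij' (c⁻¹ • ·) (c • ·) ?_ ?_ ?_ ?_ ?_
  · intro x hx
    rw [mem_fibre] at hx ⊢
    rw [map_smul, hx, inv_smul_smul]
  · intro x hx
    rw [mem_fibre] at hx ⊢
    rw [map_smul, hx]
  · intro x _
    exact smul_inv_smul c x
  · intro x _
    exact inv_smul_smul c x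
  · intro x _
    exact (ha _ x).symm

theorem prod_fibre_id {M : Type*} [CommMonoid M] (a : X → M) (x : X) :
    ∏ x' ∈ fibre (idm X) x, a x' = a x := by
  have : fibre (idm X) x = {x} := by
    ext x'
    rw [mem_fibre, Finset.mem_singleton]
    rfl
  rw [this, Finset.prod_singleton]

theorem prod_fibre_comp {M : Type*} [CommMonoid M] (g : Map Y Z) (f : Map X Y) (a : X → M)
    (z : Z) :
    ∏ x ∈ fibre (g.comp f) z, a x = ∏ y ∈ fibre g z, ∏ x ∈ fibre f y, a x := by
  classical
  rw [← Finset.prod_biUnion]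
  · congr 1
    ext x
    simp only [Finset.mem_biUnion, mem_fibre]
    exact ⟨fun h => ⟨f x, h, rfl⟩, fun ⟨y, h, h'⟩ => by rw [← h, ← h']; rfl⟩
  · intro y _ y' _ h
    refine Finset.disjoint_left.2 fun x hx hx' => h ?_
    rw [mem_fibre] at hx hx'
    rw [← hx, hx']

theorem prod_fibre_of_isCartesian {M : Type*} [CommMonoid M] {f : Map W X} {g : Map W Y}
    {h : Map X Z} {k : Map Y Z} (c : IsCartesian f g h k) (a : X → M) (y : Y) :
    ∏ v ∈ fibre g y, a (f v) = ∏ x ∈ fibre h (k y), a x := by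
  refine Finset.prod_bij (fun v _ => f v) ?_ ?_ ?_ ?_
  · intro v hv
    rw [mem_fibre] at hv ⊢
    rw [c.1, hv]
  · intro v hv v' hv' e
    rw [mem_fibre] at hv hv'
    exact (c.2 (f v') y (by rw [c.1, hv'])).unique ⟨e, hv⟩ ⟨rfl, hv'⟩
  · intro x hx
    rw [mem_fibre] at hx
    obtain ⟨v, hv, -⟩ := c.2 x y hx
    exact ⟨v, mem_fibre.2 hv.2, hv.1⟩
  · intro v _
    rfl

theorem sum_fibre_smul {M : Type*} [AddCommMonoid M] (f : Map X Y) {a : X → M}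
    (ha : ∀ (c : G) x, a (c • x) = a x) (c : G) (y : Y) :
    ∑ x ∈ fibre f (c • y), a x = ∑ x ∈ fibre f y, a x :=
  prod_fibre_smul (M := Multiplicative M) f ha c y

theorem sum_fibre_id {M : Type*} [AddCommMonoid M] (a : X → M) (x : X) :
    ∑ x' ∈ fibre (idm X) x, a x' = a x :=
  prod_fibre_id (M := Multiplicative M) a x

theorem sum_fibre_comp {M : Type*} [AddCommMonoid M] (g : Map Y Z) (f : Map X Y) (a : X → M)
    (z : Z) :
    ∑ x ∈ fibre (g.comp f) z, a x = ∑ y ∈ fibre g z, ∑ x ∈ fibre f y, a x :=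
  prod_fibre_comp (M := Multiplicative M) g f a z

theorem sum_fibre_of_isCartesian {M : Type*} [AddCommMonoid M] {f : Map W X} {g : Map W Y}
    {h : Map X Z} {k : Map Y Z} (c : IsCartesian f g h k) (a : X → M) (y : Y) :
    ∑ v ∈ fibre g y, a (f v) = ∑ x ∈ fibre h (k y), a x :=
  prod_fibre_of_isCartesian (M := Multiplicative M) c a y

/-- Expanding a product of sums over fibres gives a sum over the sections of the distributor. -/
theorem prod_fibre_sum_fibre {R : Type*} [CommSemiring R] (g : Map X Y) (h : Map Y Z)
    (a : X → R) (z : Z) :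
    ∏ y ∈ fibre h z, ∑ x ∈ fibre g y, a x =
      ∑ b ∈ fibre (distR g h) z, ∏ v ∈ fibre (distQ g h) b, a (distP g h v) := by
  classical
  rw [Finset.prod_sum]
  symm
  refine Finset.sum_bij (fun (b : DistB g h) hb y hy =>
    b.sec ⟨y, (mem_fibre.1 hy).trans (mem_fibre.1 hb).symm⟩) ?_ ?_ ?_ ?_
  · intro b hb
    rw [Finset.mem_pi]
    intro y hy
    rw [mem_fibre]
    exact b.sec_spec _
  · intro b hb b' hb' e
    have hb1 : b.base = z := mem_fibre.1 hb
    have hb1' : b'.base = z := mem_fibre.1 hb'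
    refine DistB.ext' (hb1.trans hb1'.symm) fun y e1 _ => ?_
    exact congrFun (congrFun e y) (mem_fibre.2 (e1.trans hb1))
  · intro s hs
    rw [Finset.mem_pi] at hs
    refine ⟨⟨z, fun y => s y.1 (mem_fibre.2 y.2), fun y => ?_⟩, ?_, rfl⟩
    · exact mem_fibre.1 (hs y.1 (mem_fibre.2 y.2))
    · exact mem_fibre.2 rfl
  · intro b hb
    have hb1 : b.base = z := mem_fibre.1 hb
    have hQ : ∀ v ∈ fibre (distQ g h) b, v.1.2 = b := fun v hv => mem_fibre.1 hv
    refine Finset.prod_bij (fun v hv => ⟨v.1.1, ?_⟩) ?_ ?_ ?_ ?_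
    · rw [mem_fibre, v.2, hQ v hv, hb1]
    · intro v hv
      exact Finset.mem_attach _ _
    · intro v hv v' hv' e
      exact Subtype.ext (Prod.ext (congrArg Subtype.val e) ((hQ v hv).trans (hQ v' hv').symm))
    · intro y _
      exact ⟨⟨(y.1, b), (mem_fibre.1 y.2).trans hb1.symm⟩, mem_fibre.2 rfl, rfl⟩
    · rintro ⟨⟨y, b'⟩, e⟩ hv
      obtain rfl : b' = b := hQ _ hv
      rfl

end FinGSet

section Constant

variable (G : Type u) [Group G]

/-- The Tambara functor of invariant functions with values in `R`: restrictions are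
precompositions, transfers are sums over fibres, and norms are products over fibres. -/
noncomputable def constTambara (R : Type u) [CommSemiring R] : TambaraFunctor.{u, u} G where
  obj X := {a : X.carrier → R // ∀ (c : G) x, a (c • x) = a x}
  R f a := ⟨fun x => a.1 (f x), fun c x => (congrArg a.1 (map_smul f c x)).trans (a.2 c _)⟩
  T f a := ⟨fun y => ∑ x ∈ fibre f y, a.1 x, sum_fibre_smul f a.2⟩
  N f a := ⟨fun y => ∏ x ∈ fibre f y, a.1 x, prod_fibre_smul f a.2⟩
  R_id _ := rfl
  T_id a := Subtype.ext (funext fun x => sum_fibre_id a.1 x)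
  N_id a := Subtype.ext (funext fun x => prod_fibre_id a.1 x)
  R_comp _ _ _ := rfl
  T_comp g f a := Subtype.ext (funext fun z => sum_fibre_comp g f a.1 z)
  N_comp g f a := Subtype.ext (funext fun z => prod_fibre_comp g f a.1 z)
  T_R c a := Subtype.ext (funext fun y => sum_fibre_of_isCartesian c a.1 y)
  N_R c a := Subtype.ext (funext fun y => prod_fibre_of_isCartesian c a.1 y)
  N_T g h a := Subtype.ext (funext fun z => prod_fibre_sum_fibre g h a.1 z)
  nonempty_empty := ⟨⟨fun x => x.elim, fun _ x => x.elim⟩⟩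
  subsingleton_empty := ⟨fun a b => Subtype.ext (funext fun x => x.elim)⟩
  bijective_sum X Y := by
    constructor
    · intro a b h
      refine Subtype.ext (funext ?_)
      rintro (x | y)
      · exact congrFun (congrArg (fun t => t.1.1) h) x
      · exact congrFun (congrArg (fun t => t.2.1) h) y
    · rintro ⟨a, b⟩
      refine ⟨⟨Sum.elim a.1 b.1, ?_⟩, rfl⟩
      rintro c (x | y)
      · exact a.2 c x
      · exact b.2 c y

namespace constTambara

variable {G} {R R' : Type u} [CommSemiring R] [CommSemiring R'] {X Y : FinGSet G}

/-- The element given by an invariant function. -/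
def ofFun (a : X → R) (ha : ∀ (c : G) x, a (c • x) = a x) : (constTambara G R).obj X :=
  Subtype.mk (p := fun a : X → R => ∀ (c : G) x, a (c • x) = a x) a ha

/-- The function underlying an element. -/
def val (a : (constTambara G R).obj X) : X → R :=
  Subtype.val (p := fun a : X → R => ∀ (c : G) x, a (c • x) = a x) a

theorem val_smul (a : (constTambara G R).obj X) (c : G) (x : X) : val a (c • x) = val a x :=
  Subtype.property (p := fun a : X → R => ∀ (c : G) x, a (c • x) = a x) a c x

theorem val_ext {a b : (constTambara G R).obj X} (h : ∀ x, val a x = val b x) : a = b :=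
  Subtype.ext (p := fun a : X → R => ∀ (c : G) x, a (c • x) = a x) (funext h)

theorem val_add (a b : (constTambara G R).obj X) (x : X) : val (a + b) x = val a x + val b x := by
  classical
  have hp : ∀ v, val ((constTambara G R).pair a b) v = Sum.elim (val a) (val b) v := by
    rintro (v | v)
    · exact congrFun (congrArg val (MackeyFunctor.R_inl_pair a b)) v
    · exact congrFun (congrArg val (MackeyFunctor.R_inr_pair a b)) v
  change ∑ v ∈ fibre (fold X) x, val ((constTambara G R).pair a b) v = _
  have hne : inl X X x ≠ inr X X x := Sum.inl_ne_inr
  have hf : fibre (fold X) x = {inl X X x, inr X X x} := by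
    ext v
    rw [mem_fibre, Finset.mem_insert, Finset.mem_singleton]
    rcases v with v | v
    · exact ⟨fun h => Or.inl (congrArg Sum.inl h), fun h => Sum.inl.inj
        (h.resolve_right Sum.inl_ne_inr)⟩
    · exact ⟨fun h => Or.inr (congrArg Sum.inr h), fun h => Sum.inr.inj
        (h.resolve_left Sum.inr_ne_inl)⟩
  rw [hf, Finset.sum_pair hne, hp, hp]
  rfl

theorem val_zero (x : X) : val (0 : (constTambara G R).obj X) x = 0 := by
  change ∑ v ∈ fibre (fromEmpty X) x, _ = _
  exact Finset.sum_eq_zero fun v _ => v.elim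

/-- A ring homomorphism induces a morphism of constant Tambara functors. -/
def map (φ : R →+* R') : constTambara G R ⟶ constTambara G R' where
  app _ a := ofFun (fun x => φ (val a x)) fun c x => by rw [val_smul]
  app_R _ _ := rfl
  app_T _ _ := val_ext fun _ => map_sum φ _ _
  app_N _ _ := val_ext fun _ => map_prod φ _ _

end constTambara

end Constant

/-! ### Subquotients of Tambara functors -/

/-- A partial equivalence relation on a Tambara functor that is compatible with the operations and
with disjoint unions. Its subquotient consists of the classes of the elements that are related to
themselves. -/
structure TambaraFunctor.PER {G : Type u} [Group G] (A : TambaraFunctor.{u, w} G) where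
  rel : ∀ {X : FinGSet G}, A.obj X → A.obj X → Prop
  symm : ∀ {X : FinGSet G} {a b : A.obj X}, rel a b → rel b a
  trans : ∀ {X : FinGSet G} {a b c : A.obj X}, rel a b → rel b c → rel a c
  R : ∀ {X Y : FinGSet G} (f : Map X Y) {a b : A.obj Y}, rel a b → rel (A.R f a) (A.R f b)
  T : ∀ {X Y : FinGSet G} (f : Map X Y) {a b : A.obj X}, rel a b → rel (A.T f a) (A.T f b)
  N : ∀ {X Y : FinGSet G} (f : Map X Y) {a b : A.obj X}, rel a b → rel (A.N f a) (A.N f b)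
  empty : ∀ a b : A.obj FinGSet.empty, rel a b
  sum : ∀ {X Y : FinGSet G} {a b : A.obj (X.sum Y)}, rel (A.R (inl X Y) a) (A.R (inl X Y) b) →
    rel (A.R (inr X Y) a) (A.R (inr X Y) b) → rel a b

namespace TambaraFunctor.PER

variable {G : Type u} [Group G] {A B : TambaraFunctor.{u, w} G} (r : A.PER)

/-- The equivalence relation on the elements that are related to themselves. -/
@[reducible]
def setoid (X : FinGSet G) : Setoid {a : A.obj X // r.rel a a} where
  r a b := r.rel a.1 b.1
  iseqv := ⟨fun a => a.2, r.symm, r.trans⟩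

/-- The subquotient of `A` by `r`. -/
def quotient : TambaraFunctor.{u, w} G where
  obj X := Quotient (r.setoid X)
  R f := Quotient.map (fun a => ⟨A.R f a.1, r.R f a.2⟩) (fun _ _ h => r.R f h)
  T f := Quotient.map (fun a => ⟨A.T f a.1, r.T f a.2⟩) (fun _ _ h => r.T f h)
  N f := Quotient.map (fun a => ⟨A.N f a.1, r.N f a.2⟩) (fun _ _ h => r.N f h)
  R_id := Quotient.ind fun _ => congrArg (Quotient.mk _) (Subtype.ext (A.R_id _))
  T_id := Quotient.ind fun _ => congrArg (Quotient.mk _) (Subtype.ext (A.T_id _))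
  N_id := Quotient.ind fun _ => congrArg (Quotient.mk _) (Subtype.ext (A.N_id _))
  R_comp _ _ := Quotient.ind fun _ => congrArg (Quotient.mk _) (Subtype.ext (A.R_comp _ _ _))
  T_comp _ _ := Quotient.ind fun _ => congrArg (Quotient.mk _) (Subtype.ext (A.T_comp _ _ _))
  N_comp _ _ := Quotient.ind fun _ => congrArg (Quotient.mk _) (Subtype.ext (A.N_comp _ _ _))
  T_R c := Quotient.ind fun _ => congrArg (Quotient.mk _) (Subtype.ext (A.T_R c _))
  N_R c := Quotient.ind fun _ => congrArg (Quotient.mk _) (Subtype.ext (A.N_R c _))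
  N_T _ _ := Quotient.ind fun _ => congrArg (Quotient.mk _) (Subtype.ext (A.N_T _ _ _))
  nonempty_empty := ⟨Quotient.mk _ ⟨Classical.choice A.nonempty_empty, r.empty _ _⟩⟩
  subsingleton_empty := ⟨Quotient.ind₂ fun _ _ => Quotient.sound (r.empty _ _)⟩
  bijective_sum X Y := by
    constructor
    · refine Quotient.ind₂ fun a b h => ?_
      exact Quotient.sound (r.sum (Quotient.exact (congrArg Prod.fst h))
        (Quotient.exact (congrArg Prod.snd h)))
    · rintro ⟨a, b⟩
      induction a using Quotient.ind with | _ a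
      induction b using Quotient.ind with | _ b
      have h1 := MackeyFunctor.R_inl_pair a.1 b.1
      have h2 := MackeyFunctor.R_inr_pair a.1 b.1
      refine ⟨Quotient.mk _ ⟨A.pair a.1 b.1, r.sum ?_ ?_⟩, ?_⟩
      · rw [h1]
        exact a.2
      · rw [h2]
        exact b.2
      · exact Prod.ext (congrArg (Quotient.mk _) (Subtype.ext h1))
          (congrArg (Quotient.mk _) (Subtype.ext h2))

/-- The class of an element that is related to itself. -/
def cls {X : FinGSet G} (a : A.obj X) (ha : r.rel a a) : r.quotient.obj X :=
  Quotient.mk (r.setoid X) ⟨a, ha⟩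

variable {r}

theorem exists_cls {X : FinGSet G} (x : r.quotient.obj X) : ∃ a ha, x = r.cls a ha := by
  induction x using Quotient.ind with | _ a
  exact ⟨a.1, a.2, rfl⟩

theorem cls_eq_cls {X : FinGSet G} {a b : A.obj X} {ha hb} (h : r.rel a b) :
    r.cls a ha = r.cls b hb :=
  Quotient.sound h

theorem cls_congr {X : FinGSet G} {a b : A.obj X} {ha hb} (h : a = b) : r.cls a ha = r.cls b hb :=
  congrArg (Quotient.mk _) (Subtype.ext h)

theorem rel_add {X : FinGSet G} {a b a' b' : A.obj X} (h : r.rel a a') (h' : r.rel b b') :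
    r.rel (a + b) (a' + b') := by
  refine r.T (fold X) (r.sum ?_ ?_)
  · rwa [MackeyFunctor.R_inl_pair, MackeyFunctor.R_inl_pair]
  · rwa [MackeyFunctor.R_inr_pair, MackeyFunctor.R_inr_pair]

theorem cls_add_cls {X : FinGSet G} {a b : A.obj X} (ha : r.rel a a) (hb : r.rel b b) :
    r.cls a ha + r.cls b hb = r.cls (a + b) (rel_add ha hb) := by
  have hp : r.rel (A.pair a b) (A.pair a b) := by
    apply r.sum
    · rwa [MackeyFunctor.R_inl_pair]
    · rwa [MackeyFunctor.R_inr_pair]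
  have : r.quotient.pair (r.cls a ha) (r.cls b hb) = r.cls (A.pair a b) hp := by
    apply MackeyFunctor.sum_ext
    · rw [MackeyFunctor.R_inl_pair]
      exact cls_congr (MackeyFunctor.R_inl_pair a b).symm
    · rw [MackeyFunctor.R_inr_pair]
      exact cls_congr (MackeyFunctor.R_inr_pair a b).symm
  change r.quotient.T (fold X) (r.quotient.pair _ _) = _
  rw [this]
  rfl

variable (r)

/-- A morphism to `A` whose values are related to themselves induces a morphism to the
subquotient. -/
def toQuotient (φ : B ⟶ A) (h : ∀ (X : FinGSet G) (b : B.obj X), r.rel (φ.app X b) (φ.app X b)) :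
    B ⟶ r.quotient where
  app X b := r.cls (φ.app X b) (h X b)
  app_R f b := cls_congr (φ.app_R f b)
  app_T f b := cls_congr (φ.app_T f b)
  app_N f b := cls_congr (φ.app_N f b)

/-- A morphism from `A` that identifies related elements induces a morphism from the
subquotient. -/
def fromQuotient (φ : A ⟶ B)
    (h : ∀ (X : FinGSet G) (a b : A.obj X), r.rel a b → φ.app X a = φ.app X b) :
    r.quotient ⟶ B where
  app X := Quotient.lift (fun a => φ.app X a.1) (fun _ _ e => h X _ _ e)
  app_R f := Quotient.ind fun _ => φ.app_R f _
  app_T f := Quotient.ind fun _ => φ.app_T f _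
  app_N f := Quotient.ind fun _ => φ.app_N f _

end TambaraFunctor.PER

/-! ### Pairs of subrings and groups of order two -/

/-- A product over a set with an involution, of an invariant function whose values at the fixed
points and whose squares lie in a submonoid, lies in the submonoid. -/
theorem prod_mem_of_involution {ι M : Type*} [CommMonoid M] {σ : ι → ι} (hσ : ∀ i, σ (σ i) = i)
    {a : ι → M} (ha : ∀ i, a (σ i) = a i) (B : Submonoid M) (s : Finset ι)
    (hs : ∀ i ∈ s, σ i ∈ s) (h1 : ∀ i ∈ s, σ i = i → a i ∈ B) (h2 : ∀ i ∈ s, a i * a i ∈ B) :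
    ∏ i ∈ s, a i ∈ B := by
  classical
  induction s using Finset.strongInduction with | _ s ih
  rcases s.eq_empty_or_nonempty with rfl | ⟨i, hi⟩
  · exact B.one_mem
  · rw [← Finset.mul_prod_erase s a hi]
    by_cases hf : σ i = i
    · refine B.mul_mem (h1 i hi hf) (ih _ (Finset.erase_ssubset hi) (fun j hj => ?_)
        (fun j hj => h1 j (Finset.mem_of_mem_erase hj))
        (fun j hj => h2 j (Finset.mem_of_mem_erase hj)))
      rw [Finset.mem_erase] at hj ⊢
      exact ⟨fun e => hj.1 (by rw [← hσ j, e, hf]), hs j hj.2⟩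
    · have hi' : σ i ∈ s.erase i := Finset.mem_erase.2 ⟨hf, hs i hi⟩
      rw [← Finset.mul_prod_erase _ a hi', ha, ← mul_assoc]
      have hsub : ∀ j ∈ (s.erase i).erase (σ i), j ∈ s := fun j hj =>
        Finset.mem_of_mem_erase (Finset.mem_of_mem_erase hj)
      refine B.mul_mem (h2 i hi) (ih _ ((Finset.erase_ssubset hi').trans (Finset.erase_ssubset hi))
        (fun j hj => ?_) (fun j hj => h1 j (hsub j hj)) (fun j hj => h2 j (hsub j hj)))
      rw [Finset.mem_erase, Finset.mem_erase] at hj ⊢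
      exact ⟨fun e => hj.2.1 (by rw [← hσ j, e, hσ]), fun e => hj.1 (by rw [← e, hσ]),
        hs j hj.2.2⟩

theorem sum_mem_of_involution {ι M : Type*} [AddCommMonoid M] {σ : ι → ι}
    (hσ : ∀ i, σ (σ i) = i) {a : ι → M} (ha : ∀ i, a (σ i) = a i) (B : AddSubmonoid M)
    (s : Finset ι) (hs : ∀ i ∈ s, σ i ∈ s) (h1 : ∀ i ∈ s, σ i = i → a i ∈ B)
    (h2 : ∀ i ∈ s, a i + a i ∈ B) : ∑ i ∈ s, a i ∈ B :=
  prod_mem_of_involution (M := Multiplicative M) hσ ha (AddSubmonoid.toSubmonoid B) s hs h1 h2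

theorem exists_generator_of_card_eq_two {G : Type u} [Group G] (hG : Nat.card G = 2) :
    ∃ τ : G, τ ≠ 1 ∧ τ * τ = 1 ∧ ∀ c : G, c = 1 ∨ c = τ := by
  obtain ⟨τ, hτ, h⟩ := (Nat.card_eq_two_iff' (1 : G)).1 hG
  have h' : ∀ c : G, c = 1 ∨ c = τ := fun c => by
    by_cases hc : c = 1
    · exact Or.inl hc
    · exact Or.inr (h c hc)
  refine ⟨τ, hτ, ?_, h'⟩
  exact (h' (τ * τ)).resolve_right fun e => hτ (mul_eq_left.1 e)

section Levels

variable {G : Type u} [Group G] {Q : Type u} [CommRing Q] {X Y : FinGSet G}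

/-- The function `a` takes values in `A`, and in `B` at the points that `G` fixes. -/
def IsLevelwise (A B : Subring Q) (a : X → Q) : Prop :=
  ∀ x, a x ∈ A ∧ ((∀ c : G, c • x = x) → a x ∈ B)

variable {A B : Subring Q}

theorem IsLevelwise.comp {a : Y → Q} (ha : IsLevelwise A B a) (f : Map X Y) :
    IsLevelwise A B fun x => a (f x) := fun x =>
  ⟨(ha _).1, fun hx => (ha _).2 fun c => (map_smul f c x).symm.trans (congrArg f (hx c))⟩

/-- Over a fixed point, the points of a fibre of `f` that are not fixed come in pairs. So a fibre
product is a product of values at fixed points and of squares. -/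
theorem IsLevelwise.prod_fibre (hG : Nat.card G = 2) (hAB : ∀ a ∈ A, a * a ∈ B) {a : X → Q}
    (ha : IsLevelwise A B a) (hinv : ∀ (c : G) x, a (c • x) = a x) (f : Map X Y) :
    IsLevelwise A B fun y => ∏ x ∈ fibre f y, a x := by
  obtain ⟨τ, -, hτ, h⟩ := exists_generator_of_card_eq_two hG
  refine fun y => ⟨A.prod_mem fun x _ => (ha x).1, fun hy => ?_⟩
  refine prod_mem_of_involution (σ := (τ • ·)) (fun x => by rw [smul_smul, hτ, one_smul])
    (hinv τ) B.toSubmonoid _ (fun x hx => ?_) (fun x _ hx => (ha x).2 fun c => ?_)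
    (fun x _ => hAB _ (ha x).1)
  · rw [mem_fibre] at hx ⊢
    rw [map_smul, hx, hy]
  · rcases h c with rfl | rfl
    · exact one_smul G x
    · exact hx

theorem IsLevelwise.sum_fibre (hG : Nat.card G = 2) (hAB : ∀ a ∈ A, a + a ∈ B) {a : X → Q}
    (ha : IsLevelwise A B a) (hinv : ∀ (c : G) x, a (c • x) = a x) (f : Map X Y) :
    IsLevelwise A B fun y => ∑ x ∈ fibre f y, a x := by
  obtain ⟨τ, -, hτ, h⟩ := exists_generator_of_card_eq_two hG
  refine fun y => ⟨A.sum_mem fun x _ => (ha x).1, fun hy => ?_⟩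
  refine sum_mem_of_involution (σ := (τ • ·)) (fun x => by rw [smul_smul, hτ, one_smul])
    (hinv τ) B.toAddSubgroup.toAddSubmonoid _ (fun x hx => ?_) (fun x _ hx => (ha x).2 fun c => ?_)
    (fun x _ => hAB _ (ha x).1)
  · rw [mem_fibre] at hx ⊢
    rw [map_smul, hx, hy]
  · rcases h c with rfl | rfl
    · exact one_smul G x
    · exact hx

end Levels

/-! ### A module with a nonzero norm on the kernel of the augmentation -/

namespace TwistedDual

open Polynomial

/-- The ring `𝔽₂[t]`. -/
abbrev Poly : Type := (ZMod 2)[X]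

theorem coeff_two_mul (p q : Poly) :
    (p * q).coeff 2 = p.coeff 0 * q.coeff 2 + p.coeff 1 * q.coeff 1 + p.coeff 2 * q.coeff 0 := by
  simp [coeff_mul, Finset.Nat.antidiagonal_succ]
  ring

/-- The relation `u ≡ v` modulo `t²`. -/
def relFree : Subring (Poly × Poly) where
  carrier := {p | p.1.coeff 0 = p.2.coeff 0 ∧ p.1.coeff 1 = p.2.coeff 1}
  mul_mem' {p q} hp hq := by
    obtain ⟨h0, h1⟩ := hp
    obtain ⟨k0, k1⟩ := hq
    simp only [Set.mem_ofPred_eq, Prod.fst_mul, Prod.snd_mul, mul_coeff_zero, mul_coeff_one, h0, h1,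
      k0, k1, and_self]
  one_mem' := ⟨rfl, rfl⟩
  zero_mem' := ⟨rfl, rfl⟩
  add_mem' {p q} hp hq := by
    obtain ⟨h0, h1⟩ := hp
    obtain ⟨k0, k1⟩ := hq
    simp only [Set.mem_ofPred_eq, Prod.fst_add, Prod.snd_add, coeff_add, h0, h1, k0, k1, and_self]
  neg_mem' {p} hp := by
    obtain ⟨h0, h1⟩ := hp
    simp only [Set.mem_ofPred_eq, Prod.fst_neg, Prod.snd_neg, coeff_neg, h0, h1, and_self]

/-- The relation `u ≡ v` modulo `t³` between polynomials without linear term. -/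
def relFixed : Subring (Poly × Poly) where
  carrier := {p | p.1.coeff 0 = p.2.coeff 0 ∧ p.1.coeff 1 = 0 ∧ p.2.coeff 1 = 0 ∧
    p.1.coeff 2 = p.2.coeff 2}
  mul_mem' {p q} hp hq := by
    obtain ⟨h0, h1, h1', h2⟩ := hp
    obtain ⟨k0, k1, k1', k2⟩ := hq
    simp only [Set.mem_ofPred_eq, Prod.fst_mul, Prod.snd_mul, mul_coeff_zero, mul_coeff_one,
      coeff_two_mul, h0, h1, h1', h2, k0, k1, k1', k2, mul_zero, zero_mul, add_zero, and_self]
  one_mem' := by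
    refine ⟨rfl, ?_, ?_, rfl⟩ <;> simp [coeff_one]
  zero_mem' := ⟨rfl, rfl, rfl, rfl⟩
  add_mem' {p q} hp hq := by
    obtain ⟨h0, h1, h1', h2⟩ := hp
    obtain ⟨k0, k1, k1', k2⟩ := hq
    simp only [Set.mem_ofPred_eq, Prod.fst_add, Prod.snd_add, coeff_add, h0, h1, h1', h2, k0, k1,
      k1', k2, add_zero, and_self]
  neg_mem' {p} hp := by
    obtain ⟨h0, h1, h1', h2⟩ := hp
    simp only [Set.mem_ofPred_eq, Prod.fst_neg, Prod.snd_neg, coeff_neg, h0, h1, h1', h2, neg_zero,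
      and_self]

/-- The relation `w ≡ u + v - u(0)` modulo `t²`, for `u(0) = v(0)`. -/
def sumFree : Subring (Poly × Poly × Poly) where
  carrier := {p | p.1.coeff 0 = p.2.1.coeff 0 ∧ p.2.2.coeff 0 = p.2.1.coeff 0 ∧
    p.2.2.coeff 1 = p.1.coeff 1 + p.2.1.coeff 1}
  mul_mem' {p q} hp hq := by
    obtain ⟨h0, h0', h1⟩ := hp
    obtain ⟨k0, k0', k1⟩ := hq
    refine ⟨?_, ?_, ?_⟩ <;>
      simp only [Prod.fst_mul, Prod.snd_mul, mul_coeff_zero, mul_coeff_one, h0, h0', h1, k0, k0',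
        k1]
    ring
  one_mem' := by
    refine ⟨rfl, rfl, ?_⟩
    simp [coeff_one]
  zero_mem' := ⟨rfl, rfl, (add_zero (0 : ZMod 2)).symm⟩
  add_mem' {p q} hp hq := by
    obtain ⟨h0, h0', h1⟩ := hp
    obtain ⟨k0, k0', k1⟩ := hq
    refine ⟨?_, ?_, ?_⟩ <;>
      simp only [Prod.fst_add, Prod.snd_add, coeff_add, h0, h0', h1, k0, k0', k1]
    ring
  neg_mem' {p} hp := by
    obtain ⟨h0, h0', h1⟩ := hp
    refine ⟨?_, ?_, ?_⟩ <;>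
      simp only [Prod.fst_neg, Prod.snd_neg, coeff_neg, h0, h0', h1]
    ring

/-- The relation `w ≡ u + v - u(0)` modulo `t³`, for polynomials without linear term and
`u(0) = v(0)`. -/
def sumFixed : Subring (Poly × Poly × Poly) where
  carrier := {p | p.1.coeff 0 = p.2.1.coeff 0 ∧ p.2.2.coeff 0 = p.2.1.coeff 0 ∧
    p.1.coeff 1 = 0 ∧ p.2.1.coeff 1 = 0 ∧ p.2.2.coeff 1 = 0 ∧
    p.2.2.coeff 2 = p.1.coeff 2 + p.2.1.coeff 2}
  mul_mem' {p q} hp hq := by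
    obtain ⟨h0, h0', h1, h1', h1'', h2⟩ := hp
    obtain ⟨k0, k0', k1, k1', k1'', k2⟩ := hq
    refine ⟨?_, ?_, ?_, ?_, ?_, ?_⟩ <;>
      simp only [Prod.fst_mul, Prod.snd_mul, mul_coeff_zero, mul_coeff_one, coeff_two_mul, h0, h0',
        h1, h1', h1'', h2, k0, k0', k1, k1', k1'', k2, mul_zero, zero_mul, add_zero]
    ring
  one_mem' := by
    refine ⟨rfl, rfl, ?_, ?_, ?_, ?_⟩ <;> simp [coeff_one]
  zero_mem' := ⟨rfl, rfl, rfl, rfl, rfl, (add_zero (0 : ZMod 2)).symm⟩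
  add_mem' {p q} hp hq := by
    obtain ⟨h0, h0', h1, h1', h1'', h2⟩ := hp
    obtain ⟨k0, k0', k1, k1', k1'', k2⟩ := hq
    refine ⟨?_, ?_, ?_, ?_, ?_, ?_⟩ <;>
      simp only [Prod.fst_add, Prod.snd_add, coeff_add, h0, h0', h1, h1', h1'', h2, k0, k0', k1,
        k1', k1'', k2, add_zero]
    ring
  neg_mem' {p} hp := by
    obtain ⟨h0, h0', h1, h1', h1'', h2⟩ := hp
    refine ⟨?_, ?_, ?_, ?_, ?_, ?_⟩ <;>
      simp only [Prod.fst_neg, Prod.snd_neg, coeff_neg, h0, h0', h1, h1', h1'', h2, neg_zero]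
    ring

theorem coeff_one_mul_self (p : Poly) : (p * p).coeff 1 = 0 := by
  rw [mul_coeff_one, mul_comm (p.coeff 1)]
  exact CharTwo.add_self_eq_zero _

theorem coeff_two_mul_self (p : Poly) : (p * p).coeff 2 = p.coeff 1 * p.coeff 1 := by
  rw [coeff_two_mul, mul_comm (p.coeff 2), add_right_comm, CharTwo.add_self_eq_zero, zero_add]

/-- `(a₀ + a₁ t + ⋯)² = a₀² + a₁² t² + ⋯` in characteristic `2`. -/
theorem mul_self_mem_relFixed {p : Poly × Poly} (hp : p ∈ relFree) : p * p ∈ relFixed := by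
  obtain ⟨h0, h1⟩ := hp
  refine ⟨?_, coeff_one_mul_self _, coeff_one_mul_self _, ?_⟩
  · simp only [Prod.fst_mul, Prod.snd_mul, mul_coeff_zero, h0]
  · simp only [Prod.fst_mul, Prod.snd_mul, coeff_two_mul_self, h1]

/-- The square is additive in characteristic `2`. -/
theorem mul_self_mem_sumFixed {p : Poly × Poly × Poly} (hp : p ∈ sumFree) : p * p ∈ sumFixed := by
  obtain ⟨h0, h0', h1⟩ := hp
  refine ⟨?_, ?_, coeff_one_mul_self _, coeff_one_mul_self _, coeff_one_mul_self _, ?_⟩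
  · simp only [Prod.fst_mul, Prod.snd_mul, mul_coeff_zero, h0]
  · simp only [Prod.fst_mul, Prod.snd_mul, mul_coeff_zero, h0']
  · simp only [Prod.fst_mul, Prod.snd_mul, coeff_two_mul_self, h1]
    exact CharTwo.add_mul_self _ _

theorem add_self_mem_relFixed (p : Poly × Poly) : p + p ∈ relFixed := by
  have h : p + p = 0 := Prod.ext (CharTwo.add_self_eq_zero _) (CharTwo.add_self_eq_zero _)
  rw [h]
  exact relFixed.zero_mem

end TwistedDual

namespace TwistedDual

open Polynomial
open constTambara hiding map

variable {G : Type} [Group G] (hG : Nat.card G = 2)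

/-- Two invariant functions with values in `𝔽₂[t]` are related if they agree modulo `t²` everywhere,
and if, at the fixed points, they have no linear term and agree modulo `t³`. -/
def per : (constTambara G Poly).PER where
  rel a b := IsLevelwise relFree relFixed fun x => (val a x, val b x)
  symm h x := ⟨⟨(h x).1.1.symm, (h x).1.2.symm⟩, fun hx =>
    ⟨((h x).2 hx).1.symm, ((h x).2 hx).2.2.1, ((h x).2 hx).2.1, ((h x).2 hx).2.2.2.symm⟩⟩
  trans h k x := ⟨⟨(h x).1.1.trans (k x).1.1, (h x).1.2.trans (k x).1.2⟩, fun hx =>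
    ⟨((h x).2 hx).1.trans ((k x).2 hx).1, ((h x).2 hx).2.1, ((k x).2 hx).2.2.1,
      ((h x).2 hx).2.2.2.trans ((k x).2 hx).2.2.2⟩⟩
  R f _ _ h := h.comp f
  T f a b h := by
    have h' := h.sum_fibre hG (fun a _ => add_self_mem_relFixed a)
      (fun c x => Prod.ext (val_smul a c x) (val_smul b c x)) f
    simp only [← prod_mk_sum] at h'
    exact h'
  N f a b h := by
    have h' := h.prod_fibre hG (fun a => mul_self_mem_relFixed)
      (fun c x => Prod.ext (val_smul a c x) (val_smul b c x)) f
    simp only [← prod_mk_prod] at h'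
    exact h'
  empty _ _ x := x.elim
  sum h k := by
    rintro (x | x)
    · exact ⟨(h x).1, fun hx => (h x).2 fun c => Sum.inl.inj (hx c)⟩
    · exact ⟨(k x).1, fun hx => (k x).2 fun c => Sum.inr.inj (hx c)⟩

variable {X Y : FinGSet G}

theorem C_mem_relFree {c d : ZMod 2} (h : c = d) : ((C c, C d) : Poly × Poly) ∈ relFree := by
  subst h
  exact ⟨rfl, rfl⟩

theorem C_mem_relFixed {c d : ZMod 2} (h : c = d) : ((C c, C d) : Poly × Poly) ∈ relFixed := by
  subst h
  exact ⟨rfl, coeff_C_of_ne_zero one_ne_zero, coeff_C_of_ne_zero one_ne_zero, rfl⟩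

theorem rel_map_C (a : (constTambara G (ZMod 2)).obj X) :
    (per hG).rel ((constTambara.map C).app X a) ((constTambara.map C).app X a) := fun _ =>
  ⟨C_mem_relFree rfl, fun _ => C_mem_relFixed rfl⟩

/-- The augmented algebra of the example: at a free orbit its value is `𝔽₂[t]/t²`, and at a fixed
point it is the subring of `𝔽₂[t]/t³` that is spanned by `1` and `t²`. -/
noncomputable def alg : AugAlg (constTambara G (ZMod 2)) where
  tambara := (per hG).quotient
  η := (per hG).toQuotient (constTambara.map C) fun _ a => rel_map_C hG a
  ε := (per hG).fromQuotient (constTambara.map constantCoeff) fun _ _ _ h =>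
    val_ext fun x => (h x).1.1
  η_ε := TambaraFunctor.Hom.ext (funext fun _ => funext fun _ => val_ext fun _ =>
    coeff_C_zero)

/-- The function `u + v - u(0)`. -/
noncomputable def sumFun (a b : (constTambara G Poly).obj X) : (constTambara G Poly).obj X :=
  ofFun (fun x => val a x + val b x - C ((val a x).coeff 0)) fun c x => by
    rw [val_smul, val_smul]

theorem mem_relFree_sum {p q r : Poly} (h : (p, q, r) ∈ sumFree) :
    (p + q - C (p.coeff 0), r) ∈ relFree := by
  obtain ⟨h0, h0', h1⟩ := h
  simp only at h0 h0' h1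
  refine ⟨?_, ?_⟩
  · simp only [coeff_sub, coeff_add, coeff_C_zero, h0']
    ring
  · simp only [coeff_sub, coeff_add, coeff_C_succ, h1, sub_zero]

theorem mem_relFixed_sum {p q r : Poly} (h : (p, q, r) ∈ sumFixed) :
    (p + q - C (p.coeff 0), r) ∈ relFixed := by
  obtain ⟨h0, h0', h1, h1', h1'', h2⟩ := h
  simp only at h0 h0' h1 h1' h1'' h2
  refine ⟨?_, ?_, h1'', ?_⟩
  · simp only [coeff_sub, coeff_add, coeff_C_zero, h0']
    ring
  · simp only [coeff_sub, coeff_add, coeff_C_succ, h1, h1', sub_zero, add_zero]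
  · simp only [coeff_sub, coeff_add, coeff_C_succ, h2, sub_zero]

theorem mem_sumFree_sum {p q : Poly} (h : p.coeff 0 = q.coeff 0) :
    (p, q, p + q - C (p.coeff 0)) ∈ sumFree := by
  refine ⟨h, ?_, ?_⟩
  · simp only [coeff_sub, coeff_add, coeff_C_zero]
    ring
  · simp only [coeff_sub, coeff_add, coeff_C_succ, sub_zero]

theorem mem_sumFixed_sum {p q : Poly} (h : p.coeff 0 = q.coeff 0) (hp : p.coeff 1 = 0)
    (hq : q.coeff 1 = 0) : (p, q, p + q - C (p.coeff 0)) ∈ sumFixed := by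
  refine ⟨h, ?_, hp, hq, ?_, ?_⟩
  · simp only [coeff_sub, coeff_add, coeff_C_zero]
    ring
  · simp only [coeff_sub, coeff_add, coeff_C_succ, sub_zero, hp, hq, add_zero]
  · simp only [coeff_sub, coeff_add, coeff_C_succ, sub_zero]

theorem rel_sumFun {a a' b b' : (constTambara G Poly).obj X} (h : (per hG).rel a a')
    (k : (per hG).rel b b') : (per hG).rel (sumFun a b) (sumFun a' b') := fun x => by
  have hc := (h x).1.1
  refine ⟨?_, fun hx => ?_⟩
  · change (val a x, val a' x) + (val b x, val b' x) -
      (C ((val a x).coeff 0), C ((val a' x).coeff 0)) ∈ relFree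
    exact relFree.sub_mem (relFree.add_mem (h x).1 (k x).1) (C_mem_relFree hc)
  · change (val a x, val a' x) + (val b x, val b' x) -
      (C ((val a x).coeff 0), C ((val a' x).coeff 0)) ∈ relFixed
    exact relFixed.sub_mem (relFixed.add_mem ((h x).2 hx) ((k x).2 hx)) (C_mem_relFixed hc)

/-- The norms preserve the operation `u + v - u(0)` on functions with `u(0) = v(0)`, up to the
relation. -/
theorem rel_sumFun_N (f : Map X Y) {a b : (constTambara G Poly).obj X} (ha : (per hG).rel a a)
    (hb : (per hG).rel b b) (h : ∀ x, (val a x).coeff 0 = (val b x).coeff 0) :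
    (per hG).rel ((constTambara G Poly).N f (sumFun a b))
      (sumFun ((constTambara G Poly).N f a) ((constTambara G Poly).N f b)) := by
  have h1 : IsLevelwise sumFree sumFixed fun x => (val a x, val b x, val (sumFun a b) x) :=
    fun x => ⟨mem_sumFree_sum (h x), fun hx =>
      mem_sumFixed_sum (h x) ((ha x).2 hx).2.1 ((hb x).2 hx).2.1⟩
  have h2 := h1.prod_fibre hG (fun a => mul_self_mem_sumFixed) (fun c x => Prod.ext
    (val_smul a c x) (Prod.ext (val_smul b c x) (val_smul (sumFun a b) c x))) f
  simp only [← prod_mk_prod] at h2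
  refine (per hG).symm fun y => ⟨mem_relFree_sum (h2 y).1, fun hy =>
    mem_relFixed_sum ((h2 y).2 hy)⟩

/-- The operation `u + v - u(0)` on the subquotient. -/
noncomputable def sumClass : (per hG).quotient.obj X → (per hG).quotient.obj X →
    (per hG).quotient.obj X :=
  Quotient.map₂ (fun a b => ⟨sumFun a.1 b.1, rel_sumFun hG a.2 b.2⟩)
    (fun _ _ h _ _ k => rel_sumFun hG h k)

theorem sumFun_T (f : Map X Y) (a b : (constTambara G Poly).obj X) :
    (constTambara G Poly).T f (sumFun a b) =
      sumFun ((constTambara G Poly).T f a) ((constTambara G Poly).T f b) :=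
  val_ext fun y => by
    change ∑ x ∈ fibre f y, (val a x + val b x - C ((val a x).coeff 0)) =
      ∑ x ∈ fibre f y, val a x + ∑ x ∈ fibre f y, val b x - C ((∑ x ∈ fibre f y, val a x).coeff 0)
    rw [Finset.sum_sub_distrib, Finset.sum_add_distrib, finsetSum_coeff, map_sum]

/-- The operation `u + v - u(0)` as a morphism of augmented algebras. -/
noncomputable def addHom : AugAlg.prod (alg hG) (alg hG) ⟶ alg hG where
  hom :=
    { app := fun X x => sumClass hG x.1.1 x.1.2
      app_R := by
        rintro X Y f ⟨⟨a, b⟩, h⟩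
        obtain ⟨a, ha, rfl⟩ := TambaraFunctor.PER.exists_cls a
        obtain ⟨b, hb, rfl⟩ := TambaraFunctor.PER.exists_cls b
        rfl
      app_T := by
        rintro X Y f ⟨⟨a, b⟩, h⟩
        obtain ⟨a, ha, rfl⟩ := TambaraFunctor.PER.exists_cls a
        obtain ⟨b, hb, rfl⟩ := TambaraFunctor.PER.exists_cls b
        exact TambaraFunctor.PER.cls_congr (sumFun_T f a b).symm
      app_N := by
        rintro X Y f ⟨⟨a, b⟩, h⟩
        obtain ⟨a, ha, rfl⟩ := TambaraFunctor.PER.exists_cls a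
        obtain ⟨b, hb, rfl⟩ := TambaraFunctor.PER.exists_cls b
        exact TambaraFunctor.PER.cls_eq_cls ((per hG).symm
          (rel_sumFun_N hG f ha hb fun x => congrFun (congrArg val h) x)) }
  η_hom := TambaraFunctor.Hom.ext (funext fun X => funext fun a =>
    TambaraFunctor.PER.cls_congr (val_ext fun x => by
      change C (val a x) + C (val a x) - C ((C (val a x) : Poly).coeff 0) = C (val a x)
      rw [coeff_C_zero, add_sub_cancel_right]))
  hom_ε := TambaraFunctor.Hom.ext (funext fun X => funext fun x => by
    obtain ⟨⟨a, b⟩, h⟩ := x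
    obtain ⟨a, ha, rfl⟩ := TambaraFunctor.PER.exists_cls a
    obtain ⟨b, hb, rfl⟩ := TambaraFunctor.PER.exists_cls b
    refine val_ext fun x => ?_
    have hx : (val a x).coeff 0 = (val b x).coeff 0 := congrFun (congrArg val h) x
    change (val a x + val b x - C ((val a x).coeff 0)).coeff 0 = (val a x).coeff 0
    rw [coeff_sub, coeff_add, coeff_C_zero, ← hx, add_sub_cancel_right])

/-- The module of the example. -/
noncomputable def mod : SMod (constTambara G (ZMod 2)) :=
  SMod.ofAdd (alg hG) (addHom hG)
    (fun X a b h => by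
      obtain ⟨a, ha, rfl⟩ := TambaraFunctor.PER.exists_cls a
      obtain ⟨b, hb, rfl⟩ := TambaraFunctor.PER.exists_cls b
      refine TambaraFunctor.PER.cls_congr (val_ext fun x => ?_)
      have hx : (val a x).coeff 0 = (val b x).coeff 0 := congrFun (congrArg val h) x
      change val a x + val b x - C ((val a x).coeff 0) = val b x + val a x - C ((val b x).coeff 0)
      rw [hx, add_comm])
    (fun X b => by
      obtain ⟨b, hb, rfl⟩ := TambaraFunctor.PER.exists_cls b
      refine TambaraFunctor.PER.cls_congr (val_ext fun x => ?_)
      change C ((val b x).coeff 0) + val b x - C ((C ((val b x).coeff 0) : Poly).coeff 0) = val b x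
      rw [coeff_C_zero, add_sub_cancel_left])
    (fun X a b c hab hbc _ _ => by
      obtain ⟨a, ha, rfl⟩ := TambaraFunctor.PER.exists_cls a
      obtain ⟨b, hb, rfl⟩ := TambaraFunctor.PER.exists_cls b
      obtain ⟨c, hc, rfl⟩ := TambaraFunctor.PER.exists_cls c
      refine TambaraFunctor.PER.cls_congr (val_ext fun x => ?_)
      have hx : (val a x).coeff 0 = (val b x).coeff 0 := congrFun (congrArg val hab) x
      change val a x + val b x - C ((val a x).coeff 0) + val c x -
          C ((val a x + val b x - C ((val a x).coeff 0)).coeff 0) =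
        val a x + (val b x + val c x - C ((val b x).coeff 0)) - C ((val a x).coeff 0)
      rw [coeff_sub, coeff_add, coeff_C_zero, hx]
      ring_nf)

/-! ### The comparison map of the example does not preserve norms -/

theorem additivelyComplete : (constTambara G (ZMod 2)).AdditivelyComplete := fun X a =>
  ⟨a, val_ext fun x => by
    rw [val_add, val_zero]
    exact CharTwo.add_self_eq_zero _⟩

/-- The element of the one-point `G`-set. -/
def star : (point : FinGSet G) := PUnit.unit

/-- The coefficient of `t²` at the point. -/
noncomputable def coeffTwo : (per hG).quotient.obj point → ZMod 2 :=
  Quotient.lift (fun a => (val a.1 star).coeff 2)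
    (fun _ _ h => ((h star).2 fun _ => rfl).2.2.2)

theorem coeffTwo_add (x y : (per hG).quotient.obj point) :
    coeffTwo hG (x + y) = coeffTwo hG x + coeffTwo hG y := by
  obtain ⟨a, ha, rfl⟩ := TambaraFunctor.PER.exists_cls x
  obtain ⟨b, hb, rfl⟩ := TambaraFunctor.PER.exists_cls y
  rw [TambaraFunctor.PER.cls_add_cls]
  change (val (a + b) star).coeff 2 = _
  rw [val_add, coeff_add]
  rfl

theorem coeffTwo_η (a : (constTambara G (ZMod 2)).obj point) :
    coeffTwo hG ((alg hG).η.app point a) = 0 :=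
  coeff_C_of_ne_zero two_ne_zero

/-- The regular `G`-set. -/
def regular : FinGSet G :=
  have : Finite G := Nat.finite_of_card_ne_zero (by rw [hG]; exact two_ne_zero)
  { carrier := G }

theorem eq_one_of_smul_eq {c : G} {v : regular hG} (h : c • v = v) : c = 1 :=
  mul_eq_right.1 (show @HMul.hMul G G G _ c v = v from h)

/-- A transfer from the free orbit to the point is twice a value, so it vanishes in characteristic
`2`. -/
theorem coeffTwo_T (x : (per hG).quotient.obj (regular hG)) :
    coeffTwo hG ((per hG).quotient.T (toPoint _) x) = 0 := by
  obtain ⟨τ, hτ, hττ, -⟩ := exists_generator_of_card_eq_two hG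
  obtain ⟨a, ha, rfl⟩ := TambaraFunctor.PER.exists_cls x
  have h : ∑ v ∈ fibre (toPoint (regular hG)) star, val a v ∈ (⊥ : AddSubmonoid Poly) := by
    refine sum_mem_of_involution (σ := (τ • ·)) (fun v => by rw [smul_smul, hττ, one_smul])
      (val_smul a τ) _ _ (fun _ _ => mem_fibre.2 rfl) (fun v _ hv => ?_) (fun _ _ => ?_)
    · exact absurd (eq_one_of_smul_eq hG hv) hτ
    · exact CharTwo.add_self_eq_zero _
  change (∑ v ∈ fibre (toPoint (regular hG)) star, val a v).coeff 2 = 0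
  rw [AddSubmonoid.mem_bot.1 h, coeff_zero]

/-- The constant function `t` on the regular `G`-set, which has no fixed points. -/
noncomputable def genFun : (constTambara G Poly).obj (regular hG) :=
  ofFun (fun _ => Polynomial.X) fun _ _ => rfl

theorem rel_genFun : (per hG).rel (genFun hG) (genFun hG) := fun v =>
  ⟨⟨rfl, rfl⟩, fun hv => by
    obtain ⟨τ, hτ, -, -⟩ := exists_generator_of_card_eq_two hG
    exact absurd (eq_one_of_smul_eq hG (hv τ)) hτ⟩

/-- The element `t` of the kernel of the augmentation at the free orbit. -/
noncomputable def gen : (per hG).quotient.obj (regular hG) :=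
  (per hG).cls (genFun hG) (rel_genFun hG)

theorem ε_gen : (alg hG).ε.app _ (gen hG) = 0 :=
  val_ext fun v => coeff_X_zero.trans (val_zero v).symm

/-- The norm of `t` is `t²`. -/
theorem coeffTwo_N_gen :
    coeffTwo hG ((per hG).quotient.N (toPoint _) (gen hG)) = 1 := by
  change (∏ v ∈ fibre (toPoint (regular hG)) star, (Polynomial.X : Poly)).coeff 2 = 1
  have h : (fibre (toPoint (regular hG)) star).card = 2 := by
    have : fibre (toPoint (regular hG)) star = (Set.toFinite Set.univ).toFinset := by
      ext v
      exact ⟨fun _ => (Set.Finite.mem_toFinset _).2 (Set.mem_univ v), fun _ => mem_fibre.2 rfl⟩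
    rw [this, ← Set.ncard_eq_toFinset_card, Set.ncard_univ]
    exact hG
  rw [Finset.prod_const, h, coeff_X_pow_self]

/-- Both `N_f φ(0, t) = t²` and `φ N_f(0, t) = η(N_f(0)) + T_f(c_f(0) t)` have a coefficient of
`t²`, which is `1` for the first and `0` for the second. -/
theorem not_tambara (P : NMod (constTambara G (ZMod 2)) ⥤ SMod (constTambara G (ZMod 2)))
    (e : P ⋙ SMod.toMackey _ ≅ NMod.addS _)
    (φ : SMod.Λ (constTambara G (ZMod 2)) ⋙ P ⋙ SMod.toMackey _ ⟶ SMod.toMackey _)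
    (hP : IsPi P e) (hφ : IsPhi P e φ) :
    ¬ ∃ ψ : (P.obj ((SMod.Λ _).obj (mod hG))).tambara ⟶ (mod hG).tambara,
      (TambaraFunctor.toMackey G).map ψ = φ.app (mod hG) := by
  rintro ⟨ψ, hψ⟩
  have happ : ∀ (X : FinGSet G) x,
      ψ.app X x = (mod hG).phiApp.app X ((e.hom.app ((SMod.Λ _).obj (mod hG))).app X x) :=
    fun X x => (congrArg (fun k : MackeyFunctor.Hom _ _ => k.app X x) hψ).trans (hφ _ X x)
  let m : ((SMod.Λ _).obj (mod hG)).mackey.obj (regular hG) := ⟨gen hG, ε_gen hG⟩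
  let x := (e.inv.app ((SMod.Λ _).obj (mod hG))).app (regular hG) (0, m)
  have hx : (e.hom.app ((SMod.Λ _).obj (mod hG))).app _ x = (0, m) :=
    congrArg (fun k : MackeyFunctor.Hom _ _ => k.app (regular hG) (0, m)) (e.inv_hom_id_app _)
  have h1 : ψ.app _ x = gen hG := by
    refine (happ _ x).trans ((congrArg _ hx).trans ?_)
    exact (congrArg (· + gen hG) ((mod hG).η.app_zero _)).trans (zero_add (gen hG))
  have h2 := (ψ.app_N (toPoint _) x).symm.trans ((happ _ _).trans (congrArg _
    ((hP.norm_eq _ _ _ _ x).trans (congrArg _ hx))))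
  rw [h1] at h2
  have h3 := congrArg (coeffTwo hG) h2
  refine zero_ne_one (α := ZMod 2) (Eq.trans ?_ (h3.symm.trans (coeffTwo_N_gen hG)))
  refine Eq.trans ?_ (coeffTwo_add hG _ _).symm
  refine Eq.trans (add_zero 0).symm (congrArg₂ _ (coeffTwo_η hG _).symm (coeffTwo_T hG _).symm)

end TwistedDual

theorem mainTheorem10 :
    (∀ (G : Type u) [Group G] [Finite G] (S : TambaraFunctor.{u, w} G),
      ∃ (P : NMod S ⥤ SMod S) (e : P ⋙ SMod.toMackey S ≅ NMod.addS S), IsPi P e ∧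
        (∃ θ : P ⋙ SMod.Λ S ≅ 𝟭 (NMod S), IsTheta P e θ) ∧
        ∃ φ : SMod.Λ S ⋙ P ⋙ SMod.toMackey S ⟶ SMod.toMackey S, IsPhi P e φ ∧
          (S.AdditivelyComplete → IsIso φ)) ∧
    (∀ (G : Type) [Group G], Nat.card G = 2 →
      ∃ (S : TambaraFunctor.{0, 0} G) (T : SMod S), S.AdditivelyComplete ∧
        ∀ (P : NMod S ⥤ SMod S) (e : P ⋙ SMod.toMackey S ≅ NMod.addS S)
          (φ : SMod.Λ S ⋙ P ⋙ SMod.toMackey S ⟶ SMod.toMackey S),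
          IsPi P e → IsPhi P e φ →
            ¬ ∃ ψ : (P.obj ((SMod.Λ S).obj T)).tambara ⟶ T.tambara,
              (TambaraFunctor.toMackey G).map ψ = φ.app T) :=
  ⟨fun _ _ _ S => ⟨NMod.Pi S, NMod.PiIso S, NMod.isPi_Pi S, ⟨NMod.theta S, NMod.isTheta_theta S⟩,
    SMod.phi S, SMod.isPhi_phi S, SMod.isIso_phi⟩,
  fun _ _ hG => ⟨constTambara _ (ZMod 2), TwistedDual.mod hG, TwistedDual.additivelyComplete,
    TwistedDual.not_tambara hG⟩⟩
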